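/- All graphs are finite and simple. Let $T$ be a tree. A \emph{$T$-graph} is an intersection graph of connected subgraphs of a subdivision of $T$. For $F\subseteq V(G)$ let $N(F)$ be the set of vertices outside $F$ with a neighbour in $F$, and for disjoint $F,Z\subseteq V(G)$ let the \emph{completion} of $F$ with separator $Z$ be $G[F\cup Z]$ plus a new vertex $l$ with neighbourhood $Z\cup\{l'\}$, where $l'$ (the \emph{tail}) is a new vertex of degree one. \emph{Extraction.} Let $G$ be a graph. A \emph{clique tree} is a maximum-weight spanning tree of the graph whose vertices are the maximal cliques of $G$, where intersecting cliques are joined by an edge weighted by the size of the intersection. Let $\mathcal L$ be the set of maximal cliques that have at most one neighbour in some clique tree. For a family of cliques and $A,B$ in it, $A\preceq B$ is witnessed by a member $C\ne A,B$ of the family if $G-B$ has no path from $A\setminus B$ to $C\setminus B$; $A\precneqq B$ means $A\preceq B$ and $B\not\preceq A$; $A\approx B$ means that $A\preceq B$ and $B\preceq A$ have a common witness. Let $\mathcal L_0$ be the set of $L\in\mathcal L$ such that $L'\precneqq L$ (relative to $\mathcal L$) for no $L'\in\mathcal L$, and $\mathcal L_1$ the set of $L\in\mathcal L_0$ such that $L\approx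 L'$ (relative to $\mathcal L_0$) for no $L'\in\mathcal L_0\setminus\{L\}$. (i) If $\mathcal L_1\neq\emptyset$, output, for each $L\in\mathcal L_1$, the set of all simplicial vertices of $G$ in $L$ (omitting the empty set). (ii) Otherwise, let $\mathcal Z$ be the set of inclusion-minimal sets $Z$ for which there are distinct $L_1\approx L_2$ in $\mathcal L_0$ with $Z\subseteq L_1\cap L_2$ and some $L\in\mathcal L_0\setminus\{L_1,L_2\}$ such that $G-Z$ has no path from $L_1\mathbin\Delta L_2$ to $L\setminus Z$. Let $\mathcal C_0$ be the set of (vertex sets of) components $F$ of $G-\bigcup\mathcal Z$ with $N(F)\in\mathcal Z$. Obtain $\mathcal C_0'$ from $\mathcal C_0$ by uniting, for each $Z\in\mathcal Z$, all $F$ with $N(F)=Z$ all of whose vertices are adjacent to all of $Z$. Let $\mathcal C_1$ be the set of $F\in\mathcal C_0'$ whose completion $F^+$ (with separator $N(F)$) is an interval graph. If $\mathcal C_1\ne\emptyset$, output $\mathcal C_1$. (iii) Otherwise, apply the extraction recursively to $F^+$ for each $F\in\mathcal C_0'$, and output all those resulting sets that are subsets of the respective $F$. \emph{Canonical decomposition.}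 Let $G_0:=G$. For $i=1,2,\dots$ let the level $\mathcal X_i$ be the output of the extraction on $G_{i-1}$ and let $G_i$ be $G_{i-1}$ without the vertices in members of $\mathcal X_i$; stop at the first $i$ for which $G_i$ is an interval graph, and if $G_i$ is not empty, add one last level $\mathcal X_{i+1}:=\{V(G_i)\}$. The members of the levels are called \emph{fragments}. Let $G_1,G_2$ be connected $T$-graphs that have canonical decompositions, with the same number $\ell$ of levels $\mathcal X^1_i$ and $\mathcal X^2_i$. Let $H=G_1\uplus G_2$, $\mathcal X_i=\mathcal X^1_i\cup\mathcal X^2_i$ and $\mathcal X=\mathcal X_1\cup\dots\cup\mathcal X_\ell$. For $X\in\mathcal X_i$ let $Z_X$ be the set of vertices that lie in fragments of levels higher than $i$ and have a neighbour in $X$; let $X^+$ be the completion of $X$ in $H$ with separator $Z_X$; and let the \emph{attachment sets} of $X$ be the sets $N_H(v)\cap Z_X$ for $v\in X$. For $X\in\mathcal X_k$ and $j<k$ let $\mathcal A^j[X]$ be the family of all nonempty sets $B\cap X$ where $B$ is an attachment set of a fragment in $\mathcal X_j$ (the \emph{terminal sets} in $X$); let $\mathcal A^j_k=\bigcup_{X\in\mathcal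 X_k}\mathcal A^j[X]$ and let $\mathcal A$ be the union of all $\mathcal A^j_k$. Attachment sets $B$ of $X$ and $B'$ of $X'$, where $X,X'\in\mathcal X_i$, \emph{correspond} if some isomorphism from $X^+$ to $X'^+$ that preserves the tail maps $B$ to $B'$. Let $\varrho$ be a permutation of the disjoint union of $\mathcal X$ and $\mathcal A$. Then the following two conditions hold: (A1) for every $i$ and $X\in\mathcal X_i$ we have $\varrho(X)\in\mathcal X_i$, and there is an isomorphism from $X^+$ to $\varrho(X)^+$ that maps tail to tail and, for all $j<i$, maps every terminal set $A\in\mathcal A^j[X]$ to $\varrho(A)$, which belongs to $\mathcal A^j[\varrho(X)]$; (A2) for all $i<k$, $X\in\mathcal X_i$ and $A\in\mathcal A^i_k$, if $A$ is the part in a fragment of $\mathcal X_k$ of an attachment set $B$ of $X$ (that is, $A=B\cap Y$ for some $Y\in\mathcal X_k$), then $\varrho(A)$ is the part in a fragment of $\mathcal X_k$ of an attachment set of $\varrho(X)$ corresponding to $B$; if and only if there is an automorphism $\sigma$ of the graph $H$ with $\sigma(X)=\varrho(X)$ for all $X\in\mathcal X$ and $\sigma(A)=\varrho(A)$ for all $A\in\mathcal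 A$. -/

import Mathlib

namespace TGraphDecomp

universe u w

/-! ### Graph classes -/

/-- Subdividing the edge `uv` of `G` once: the edge is replaced by the path `u - none - v`. -/
def subdivideEdge {W : Type w} (G : SimpleGraph W) (u v : W) : SimpleGraph (Option W) where
  Adj
    | some a, some b => G.Adj a b ∧ s(a, b) ≠ s(u, v)
    | some a, none => a = u ∨ a = v
    | none, some a => a = u ∨ a = v
    | none, none => False
  symm := ⟨by
    rintro (_ | a) (_ | b) h
    · exact h
    · exact h
    · exact h
    · exact ⟨h.1.symm, by rw [Sym2.eq_swap]; exact h.2⟩⟩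
  loopless := ⟨by
    rintro (_ | a) h
    · exact h
    · exact G.loopless.irrefl a h.1⟩

/-- `IsSubdivision T T'`: the graph `T'` arises from `T` by subdividing edges, one at a time. -/
inductive IsSubdivision {τ : Type w} (T : SimpleGraph τ) :
    {W : Type w} → SimpleGraph W → Prop
  | refl : IsSubdivision T T
  | step {W : Type w} (T' : SimpleGraph W) (u v : W) (huv : T'.Adj u v)
      (h : IsSubdivision T T') : IsSubdivision T (subdivideEdge T' u v)

/-- `G` is a `T`-graph: the intersection graph of connected subgraphs of a subdivision of `T`
(in a tree, a connected subgraph is given by its vertex set). -/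
def IsTGraph {τ : Type w} (T : SimpleGraph τ) {V : Type u} (G : SimpleGraph V) : Prop :=
  ∃ (W : Type w) (T' : SimpleGraph W), IsSubdivision T T' ∧
    ∃ f : V → Set W, (∀ v, (T'.induce (f v)).Connected) ∧
      ∀ u v, u ≠ v → (G.Adj u v ↔ (f u ∩ f v).Nonempty)

/-- `G` is an interval graph: the intersection graph of closed intervals of the real line. -/
def IsIntervalGraph {V : Type u} (G : SimpleGraph V) : Prop :=
  ∃ a b : V → ℝ, (∀ v, a v ≤ b v) ∧
    ∀ u v, u ≠ v → (G.Adj u v ↔ (Set.Icc (a u) (b u) ∩ Set.Icc (a v) (b v)).Nonempty)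

section Basic

variable {V : Type u} (G : SimpleGraph V)

/-! ### Clique trees and leaf cliques -/

/-- `K` is an inclusion-maximal clique of `G`. -/
def IsMaxClique (K : Set V) : Prop := Maximal (fun S : Set V => G.IsClique S) K

/-- The clique graph: vertices are the maximal cliques, edges join intersecting ones. -/
def cliqueGraph : SimpleGraph {K : Set V // IsMaxClique G K} where
  Adj K L := K ≠ L ∧ (K.1 ∩ L.1).Nonempty
  symm := ⟨fun _ _ h => ⟨h.1.symm, by rw [Set.inter_comm]; exact h.2⟩⟩
  loopless := ⟨fun _ h => h.1 rfl⟩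

/-- The weight of an edge of the clique graph: the size of the intersection of its ends. -/
noncomputable def edgeWeight : Sym2 {K : Set V // IsMaxClique G K} → ℕ :=
  Sym2.lift ⟨fun K L => (K.1 ∩ L.1).ncard, fun K L => by simp only [Set.inter_comm]⟩

/-- The total weight of a graph on the maximal cliques of `G`. -/
noncomputable def weight (T : SimpleGraph {K : Set V // IsMaxClique G K}) : ℕ :=
  ∑ᶠ e ∈ T.edgeSet, edgeWeight G e

/-- A clique tree of `G`: a maximum-weight spanning tree of the weighted clique graph. -/
def IsCliqueTree (T : SimpleGraph {K : Set V // IsMaxClique G K}) : Prop :=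
  (T ≤ cliqueGraph G ∧ T.IsTree) ∧
    ∀ T' : SimpleGraph {K : Set V // IsMaxClique G K},
      T' ≤ cliqueGraph G → T'.IsTree → weight G T' ≤ weight G T

/-- The family of leaf cliques: the maximal cliques which have at most one neighbour in some
clique tree (the only clique of a complete graph counts as a leaf). -/
def leafCliques : Set (Set V) :=
  {K | ∃ hK : IsMaxClique G K, ∃ T, IsCliqueTree G T ∧
    ∀ L L', T.Adj ⟨K, hK⟩ L → T.Adj ⟨K, hK⟩ L' → L = L'}

/-- The simplicial vertices of `G`: those whose neighbourhood is a clique. -/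
def simplicial : Set V := {v | G.IsClique (G.neighborSet v)}

/-! ### Separation -/

/-- `S` separates `P` from `Q` in `G`: there is no path from `P \ S` to `Q \ S` in `G - S`. -/
def Separates (S P Q : Set V) : Prop :=
  ∀ p ∈ P \ S, ∀ q ∈ Q \ S, ∀ p' : G.Walk p q, ∃ x ∈ p'.support, x ∈ S

/-- `A ⪯ B`, witnessed by the member `C` of the family `𝓛`. -/
def PrecBy (𝓛 : Set (Set V)) (A B C : Set V) : Prop :=
  C ∈ 𝓛 ∧ C ≠ A ∧ C ≠ B ∧ Separates G B A C

/-- The preorder `A ⪯ B` with respect to the family `𝓛`. -/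
def Prec (𝓛 : Set (Set V)) (A B : Set V) : Prop := ∃ C, PrecBy G 𝓛 A B C

/-- The strict part of `⪯`. -/
def StrictPrec (𝓛 : Set (Set V)) (A B : Set V) : Prop := Prec G 𝓛 A B ∧ ¬ Prec G 𝓛 B A

/-- `A ≈ B`: both `A ⪯ B` and `B ⪯ A` hold and have a common witness. -/
def Approx (𝓛 : Set (Set V)) (A B : Set V) : Prop :=
  ∃ C, PrecBy G 𝓛 A B C ∧ PrecBy G 𝓛 B A C

/-- `𝓛₀`: the leaf cliques with no leaf clique strictly below them. -/
def leaf0 : Set (Set V) :=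
  {L | L ∈ leafCliques G ∧ ∀ L' ∈ leafCliques G, ¬ StrictPrec G (leafCliques G) L' L}

/-- `𝓛₁`: the members of `𝓛₀` which are not `≈`-related to another member of `𝓛₀`. -/
def leaf1 : Set (Set V) :=
  {L | L ∈ leaf0 G ∧ ∀ L' ∈ leaf0 G, L' ≠ L → ¬ Approx G (leaf0 G) L L'}

/-- `Z` is a joint separator for `L₁`, `L₂`. -/
def IsJointSeparator (L₁ L₂ Z : Set V) : Prop :=
  Z ⊆ L₁ ∩ L₂ ∧ ∃ L ∈ leaf0 G, L ≠ L₁ ∧ L ≠ L₂ ∧ Separates G Z (symmDiff L₁ L₂) L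

/-- `𝓩`: the inclusion-minimal sets among all joint separators of `≈`-related pairs. -/
def separators : Set (Set V) :=
  {Z | Minimal (fun Z : Set V => ∃ L₁ ∈ leaf0 G, ∃ L₂ ∈ leaf0 G,
    L₁ ≠ L₂ ∧ Approx G (leaf0 G) L₁ L₂ ∧ IsJointSeparator G L₁ L₂ Z) Z}

/-- The neighbourhood of a vertex set `F`: the vertices outside of `F` with a neighbour in `F`. -/
def boundary (F : Set V) : Set V := {w | w ∉ F ∧ ∃ v ∈ F, G.Adj v w}

/-- `F` is (the vertex set of) a connected component of `G - U`. -/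
def IsComponent (U F : Set V) : Prop :=
  Disjoint F U ∧ (G.induce F).Connected ∧ boundary G F ⊆ U

/-- `𝓒₀`: the components of `G - ⋃ 𝓩` incident to just one member of `𝓩`, that is, those whose
neighbourhood is a member of `𝓩`. -/
def comp0 : Set (Set V) :=
  {F | IsComponent G (⋃₀ separators G) F ∧ boundary G F ∈ separators G}

/-- Every vertex of `F` is adjacent to the whole neighbourhood of `F`. -/
def IsFull (F : Set V) : Prop := ∀ v ∈ F, ∀ z ∈ boundary G F, G.Adj v z

/-- `𝓒₀'`: for each `Z` the full components with neighbourhood `Z` are joined into one graph, the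
other members of `𝓒₀` are kept. -/
def comp0' : Set (Set V) :=
  {F | F ∈ comp0 G ∧ ¬ IsFull G F} ∪
    {F | ∃ Z ∈ separators G, (∃ F' ∈ comp0 G, boundary G F' = Z ∧ IsFull G F') ∧
      F = ⋃₀ {F' | F' ∈ comp0 G ∧ boundary G F' = Z ∧ IsFull G F'}}

/-! ### Completions -/

/-- The completion of `F` with separator `Z`: the graph induced on `F ∪ Z`, together with a new
vertex `l = inr false` whose neighbours are the vertices of `Z` and the tail `l' = inr true`, the
latter being a leaf attached to `l`. -/
def completion (F Z : Set V) : SimpleGraph (↥(F ∪ Z) ⊕ Bool) where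
  Adj
    | Sum.inl a, Sum.inl b => G.Adj a.1 b.1
    | Sum.inl a, Sum.inr b => a.1 ∈ Z ∧ b = false
    | Sum.inr b, Sum.inl a => a.1 ∈ Z ∧ b = false
    | Sum.inr b, Sum.inr b' => b ≠ b'
  symm := ⟨by
    rintro (a | a) (b | b) h
    · exact SimpleGraph.Adj.symm h
    · exact h
    · exact h
    · exact Ne.symm h⟩
  loopless := ⟨by
    rintro (a | a) h
    · exact G.loopless.irrefl _ h
    · exact h rfl⟩

/-- The vertices of a completion that come from the set `A`. -/
def inCompletion (F Z A : Set V) : Set (↥(F ∪ Z) ⊕ Bool) :=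
  {x | ∃ v : ↥(F ∪ Z), x = Sum.inl v ∧ v.1 ∈ A}

/-- `𝓒₁`: the members of `𝓒₀'` whose completion is an interval graph. -/
def comp1 : Set (Set V) :=
  {F | F ∈ comp0' G ∧ IsIntervalGraph (completion G F (boundary G F))}

end Basic

/-! ### The fragment collection of a graph -/

/-- `Extract G 𝓕`: the extraction procedure, run on `G`, outputs the fragment collection `𝓕`
(fragments are nonempty by definition, and are given by their vertex sets). -/
inductive Extract : {V : Type u} → SimpleGraph V → Set (Set V) → Prop
  /-- Some leaf clique is `≈`-incomparable: output the simplicial vertices of all of these. -/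
  | simplicial {V : Type u} (G : SimpleGraph V) (h1 : (leaf1 G).Nonempty) :
      Extract G {F | F.Nonempty ∧ ∃ L ∈ leaf1 G, F = L ∩ simplicial G}
  /-- Otherwise, output `𝓒₁` if it is not empty. -/
  | interval {V : Type u} (G : SimpleGraph V) (h1 : leaf1 G = ∅) (h2 : (comp1 G).Nonempty) :
      Extract G (comp1 G)
  /-- Otherwise, call the procedure on the completions of all `F ∈ 𝓒₀'`, and output the fragments
  found there which are subgraphs of `F`. -/
  | recurse {V : Type u} (G : SimpleGraph V) (h1 : leaf1 G = ∅) (h2 : comp1 G = ∅)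
      (S : ∀ F : Set V, Set (Set (↥(F ∪ boundary G F) ⊕ Bool)))
      (hS : ∀ F ∈ comp0' G, Extract (completion G F (boundary G F)) (S F)) :
      Extract G {X | ∃ F ∈ comp0' G, X ⊆ F ∧ inCompletion F (boundary G F) X ∈ S F}

/-! ### Canonical decompositions -/

section Levels

variable {V : Type u} {ℓ : ℕ}

/-- The vertices which are in no fragment of a level before level `i`. -/
def remaining (𝓧 : Fin ℓ → Set (Set V)) (i : Fin ℓ) : Set V :=
  {v | ∀ j < i, ∀ X ∈ 𝓧 j, v ∉ X}

/-- The levels `𝓧 0, 𝓧 1, …, 𝓧 (ℓ - 1)` form the canonical decomposition of `G`: levels are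
extracted one after the other from what remains of `G` (at least one of them), until an interval
graph remains; this, unless empty, is the only fragment of the last level. -/
structure IsCanonicalDecomposition (G : SimpleGraph V) (𝓧 : Fin ℓ → Set (Set V)) : Prop where
  extract : ∀ i : Fin ℓ, (i.1 = 0 ∨ ¬ IsIntervalGraph (G.induce (remaining 𝓧 i))) →
    ∃ 𝓕 : Set (Set ↥(remaining 𝓧 i)), Extract (G.induce (remaining 𝓧 i)) 𝓕 ∧
      𝓧 i = {X | ∃ F ∈ 𝓕, X = Subtype.val '' F}
  last : ∀ i : Fin ℓ, i.1 ≠ 0 → IsIntervalGraph (G.induce (remaining 𝓧 i)) →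
    (remaining 𝓧 i).Nonempty ∧ 𝓧 i = {remaining 𝓧 i}
  exhausts : ∀ v : V, ∃ i, ∃ X ∈ 𝓧 i, v ∈ X

/-- The levels of the combined decomposition of a disjoint union. -/
def combine {V₁ : Type u} {V₂ : Type w} (𝓧₁ : Fin ℓ → Set (Set V₁)) (𝓧₂ : Fin ℓ → Set (Set V₂)) :
    Fin ℓ → Set (Set (V₁ ⊕ V₂)) :=
  fun i => {X | (∃ Y ∈ 𝓧₁ i, X = Sum.inl '' Y) ∨ (∃ Y ∈ 𝓧₂ i, X = Sum.inr '' Y)}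

variable (H : SimpleGraph V) (𝓧 : Fin ℓ → Set (Set V))

/-- The union of the vertex sets of the fragments of the levels higher than `i`. -/
def above (i : Fin ℓ) : Set V := {v | ∃ k, i < k ∧ ∃ X ∈ 𝓧 k, v ∈ X}

/-- The separator of a fragment `X` of level `i`: its neighbourhood in the higher levels. -/
def fragSep (i : Fin ℓ) (X : Set V) : Set V := {w | w ∈ above 𝓧 i ∧ ∃ v ∈ X, H.Adj v w}

/-- The attachment sets of a fragment `X` of level `i`: the sets of neighbours in the separator of
`X` of the single vertices of `X`. -/
def attachments (i : Fin ℓ) (X : Set V) : Set (Set V) :=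
  {B | ∃ v ∈ X, B = H.neighborSet v ∩ fragSep H 𝓧 i X}

/-- `𝓐ʲ[X]`: the terminal sets of the fragment `X` that come from level `j`, which are the nonempty
traces on `X` of the attachment sets of the fragments of level `j`. -/
def terminalsIn (j : Fin ℓ) (X : Set V) : Set (Set V) :=
  {A | A.Nonempty ∧ ∃ Y ∈ 𝓧 j, ∃ B ∈ attachments H 𝓧 j Y, A = B ∩ X}

/-- `𝓐ₖʲ`: the terminal sets of level `k` that come from level `j`. -/
def terminals (j k : Fin ℓ) : Set (Set V) := {A | ∃ X ∈ 𝓧 k, A ∈ terminalsIn H 𝓧 j X}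

/-- `𝓧`, the set of all fragments. -/
abbrev Fragments : Type u := {X : Set V // ∃ i, X ∈ 𝓧 i}

/-- `𝓐`, the set of all terminal sets. -/
abbrev Terminals : Type u := {A : Set V // ∃ j k, j < k ∧ A ∈ terminals H 𝓧 j k}

/-- The completion `X⁺` of a fragment `X` of level `i`. -/
abbrev plus (i : Fin ℓ) (X : Set V) : SimpleGraph (↥(X ∪ fragSep H 𝓧 i X) ⊕ Bool) :=
  completion H X (fragSep H 𝓧 i X)

/-- The vertices of `X⁺` that come from the set `A`. -/
abbrev inPlus (i : Fin ℓ) (X A : Set V) : Set (↥(X ∪ fragSep H 𝓧 i X) ⊕ Bool) :=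
  inCompletion X (fragSep H 𝓧 i X) A

/-- The attachment set `B` of the level `i` fragment `X` corresponds to the attachment set `B'` of
the level `i` fragment `X'`: an isomorphism of `X⁺` to `X'⁺` preserving the tail maps `B` to `B'`. -/
def Corresponds (i : Fin ℓ) (X B X' B' : Set V) : Prop :=
  ∃ ι : plus H 𝓧 i X ≃g plus H 𝓧 i X',
    ι (Sum.inr true) = Sum.inr true ∧ ι '' inPlus H 𝓧 i X B = inPlus H 𝓧 i X' B'

/-- Consistency on a level: `ϱ` maps every fragment `X` to a fragment `X'` of the same level, so
that some isomorphism `X⁺ → X'⁺` preserves the tail and maps the terminal sets in `𝓐ʲ[X]` to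
terminal sets in `𝓐ʲ[X']` as `ϱ` does. -/
def CondA1 (ϱ : Equiv.Perm (Fragments 𝓧 ⊕ Terminals H 𝓧)) : Prop :=
  ∀ (i : Fin ℓ) (X : Fragments 𝓧), X.1 ∈ 𝓧 i →
    ∃ X' : Fragments 𝓧, ϱ (Sum.inl X) = Sum.inl X' ∧ X'.1 ∈ 𝓧 i ∧
      ∃ ι : plus H 𝓧 i X.1 ≃g plus H 𝓧 i X'.1, ι (Sum.inr true) = Sum.inr true ∧
        ∀ j < i, ∀ A : Terminals H 𝓧, A.1 ∈ terminalsIn H 𝓧 j X.1 →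
          ∃ A' : Terminals H 𝓧, ϱ (Sum.inr A) = Sum.inr A' ∧ A'.1 ∈ terminalsIn H 𝓧 j X'.1 ∧
            ι '' inPlus H 𝓧 i X.1 A.1 = inPlus H 𝓧 i X'.1 A'.1

/-- Consistency between levels: if the terminal set `A` of level `k` is the part of an attachment
set `B` of the level `i` fragment `X` in a fragment of level `k`, then `ϱ A` is such a part of the
corresponding attachment set of the fragment `ϱ X`. -/
def CondA2 (ϱ : Equiv.Perm (Fragments 𝓧 ⊕ Terminals H 𝓧)) : Prop :=
  ∀ (i k : Fin ℓ), i < k → ∀ (X : Fragments 𝓧) (A : Terminals H 𝓧),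
    X.1 ∈ 𝓧 i → A.1 ∈ terminals H 𝓧 i k →
    ∀ B ∈ attachments H 𝓧 i X.1, (∃ Y ∈ 𝓧 k, A.1 = B ∩ Y) →
      ∃ (X' : Fragments 𝓧) (A' : Terminals H 𝓧),
        ϱ (Sum.inl X) = Sum.inl X' ∧ ϱ (Sum.inr A) = Sum.inr A' ∧
        ∃ B' ∈ attachments H 𝓧 i X'.1, Corresponds H 𝓧 i X.1 B X'.1 B' ∧
          ∃ Y' ∈ 𝓧 k, A'.1 = B' ∩ Y'

/-- `ϱ` is an automorphism of the decomposition. -/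
def IsDecompAut (ϱ : Equiv.Perm (Fragments 𝓧 ⊕ Terminals H 𝓧)) : Prop :=
  CondA1 H 𝓧 ϱ ∧ CondA2 H 𝓧 ϱ

/-- The graph automorphism `σ` acts on `𝓧` and on `𝓐` exactly as `ϱ` does. -/
def ActsAs (σ : H ≃g H) (ϱ : Equiv.Perm (Fragments 𝓧 ⊕ Terminals H 𝓧)) : Prop :=
  (∀ X : Fragments 𝓧, ∃ X' : Fragments 𝓧, ϱ (Sum.inl X) = Sum.inl X' ∧ σ '' X.1 = X'.1) ∧
    ∀ A : Terminals H 𝓧, ∃ A' : Terminals H 𝓧, ϱ (Sum.inr A) = Sum.inr A' ∧ σ '' A.1 = A'.1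

end Levels

end TGraphDecomp

/-! From a graph automorphism to `ϱ`: the extraction is defined by isomorphism-invariant notions
only, so canonical decompositions are unique and carried along by isomorphisms
(`Extract.mem_image_iff`, `IsCanonicalDecomposition.mem_image_iff`). As `G₁` and `G₂` are connected,
an automorphism of the union fixes or swaps them, so it permutes each level (`image_mem_combine`).
Its restrictions to completions then witness (A1) and (A2) (`ActsAs.isDecompAut`).

From `ϱ` to a graph automorphism: the isomorphisms from (A1), each restricted to its own fragment,
are glued. Fragments partition the vertices, so the result is a bijection, and edges inside
fragments are kept. Distinct fragments of one level have no edges between them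
(`Extract.isSeparated`). For an edge from `v` in `X` to `w` in a higher fragment `Y`, (A1) and (A2)
place the image of `w` in an attachment set of `ϱ X` that corresponds to that of `v`, though perhaps
under another isomorphism. The attachment sets of a fragment form a chain (`Extract.isNested`), so
size determines them, and this set is the one of the image of `v`. The chain property comes from
interval models: a connected part lies on one side of `l`, where adjacency to the separator is
monotone. The properties used in this direction are collected in `IsLayered`. -/

namespace TGraphDecomp

universe u w

/-! ### Invariance of the extraction under isomorphisms -/

section Transport

variable {V : Type u} {V' : Type w} {G : SimpleGraph V} {G' : SimpleGraph V'} (e : G ≃g G')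

/-- With surjectivity, quantifiers over vertex sets of `G'` become quantifiers over images of sets
of `G`; each notion of the extraction is transported in this way. -/
lemma iso_image_surjective : Function.Surjective (fun S : Set V => e '' S) :=
  Set.image_surjective.mpr e.surjective

lemma iso_image_subset {A B : Set V} : e '' A ⊆ e '' B ↔ A ⊆ B :=
  Set.image_subset_image_iff e.injective

lemma iso_image_inj {A B : Set V} : e '' A = e '' B ↔ A = B :=
  e.injective.image_injective.eq_iff

lemma isClique_image_iff {K : Set V} : G'.IsClique (e '' K) ↔ G.IsClique K := by
  rw [SimpleGraph.isClique_iff, SimpleGraph.isClique_iff, e.injective.injOn.pairwise_image]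
  simp only [Set.Pairwise, Function.onFun, e.map_adj_iff]

/-- Minimality is preserved by the action of an isomorphism on vertex sets. -/
lemma minimal_image_iff {P : Set V → Prop} {P' : Set V' → Prop}
    (h : ∀ S, P' (e '' S) ↔ P S) (K : Set V) : Minimal P' (e '' K) ↔ Minimal P K := by
  simp only [Minimal, (iso_image_surjective e).forall, h, iso_image_subset]

/-- Maximality is preserved by the action of an isomorphism on vertex sets. -/
lemma maximal_image_iff {P : Set V → Prop} {P' : Set V' → Prop}
    (h : ∀ S, P' (e '' S) ↔ P S) (K : Set V) : Maximal P' (e '' K) ↔ Maximal P K := by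
  simp only [Maximal, (iso_image_surjective e).forall, h, iso_image_subset]

lemma isMaxClique_image_iff {K : Set V} : IsMaxClique G' (e '' K) ↔ IsMaxClique G K :=
  maximal_image_iff e (fun _ => isClique_image_iff e) K

/-- The action of an isomorphism on maximal cliques. -/
noncomputable def maxCliqueEquiv :
    {K : Set V // IsMaxClique G K} ≃ {K : Set V' // IsMaxClique G' K} :=
  Equiv.ofBijective (fun K => ⟨e '' K.1, (isMaxClique_image_iff e).2 K.2⟩) <| by
    refine ⟨fun K L h => Subtype.ext ((iso_image_inj e).1 (congrArg Subtype.val h)), ?_⟩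
    rintro ⟨K, hK⟩
    obtain ⟨K, rfl⟩ := iso_image_surjective e K
    exact ⟨⟨K, (isMaxClique_image_iff e).1 hK⟩, rfl⟩

lemma maxCliqueEquiv_val (K : {K : Set V // IsMaxClique G K}) :
    (maxCliqueEquiv e K).1 = e '' K.1 := rfl

lemma maxCliqueEquiv_inter (K L : {K : Set V // IsMaxClique G K}) :
    (maxCliqueEquiv e K).1 ∩ (maxCliqueEquiv e L).1 = e '' (K.1 ∩ L.1) := by
  rw [maxCliqueEquiv_val, maxCliqueEquiv_val, Set.image_inter e.injective]

lemma comap_cliqueGraph : (cliqueGraph G').comap (maxCliqueEquiv e) = cliqueGraph G := by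
  ext K L
  simp only [SimpleGraph.comap_adj, cliqueGraph, maxCliqueEquiv_inter, Set.image_nonempty, ne_eq,
    EmbeddingLike.apply_eq_iff_eq]

lemma weight_comap (T : SimpleGraph {K : Set V' // IsMaxClique G' K}) :
    weight G (T.comap (maxCliqueEquiv e)) = weight G' T := by
  refine finsum_mem_eq_of_bijOn (Sym2.map (maxCliqueEquiv e)) ⟨?_, ?_, ?_⟩ ?_
  · intro x
    induction x with | _ K L => exact id
  · exact (Sym2.map.injective (maxCliqueEquiv e).injective).injOn
  · intro x
    induction x with | _ K L =>
      obtain ⟨K, rfl⟩ := (maxCliqueEquiv e).surjective K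
      obtain ⟨L, rfl⟩ := (maxCliqueEquiv e).surjective L
      exact fun h => ⟨s(K, L), h, rfl⟩
  · intro x _
    induction x with | _ K L =>
      simp only [edgeWeight, Sym2.map_mk, Sym2.lift_mk, maxCliqueEquiv_inter,
        Set.ncard_image_of_injective _ e.injective]

lemma comap_maxCliqueEquiv_surjective :
    Function.Surjective (fun T : SimpleGraph {K : Set V' // IsMaxClique G' K} =>
      T.comap (maxCliqueEquiv e)) := fun T =>
  ⟨T.comap (maxCliqueEquiv e).symm, by ext; simp⟩

lemma comap_le_cliqueGraph_iff (T : SimpleGraph {K : Set V' // IsMaxClique G' K}) :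
    T.comap (maxCliqueEquiv e) ≤ cliqueGraph G ↔ T ≤ cliqueGraph G' := by
  rw [← comap_cliqueGraph e]
  refine ⟨fun h K L => ?_, fun h K L => @h _ _⟩
  obtain ⟨K, rfl⟩ := (maxCliqueEquiv e).surjective K
  obtain ⟨L, rfl⟩ := (maxCliqueEquiv e).surjective L
  exact @h K L

lemma isCliqueTree_comap_iff (T : SimpleGraph {K : Set V' // IsMaxClique G' K}) :
    IsCliqueTree G (T.comap (maxCliqueEquiv e)) ↔ IsCliqueTree G' T := by
  have hT (T : SimpleGraph {K : Set V' // IsMaxClique G' K}) :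
      (T.comap (maxCliqueEquiv e)).IsTree ↔ T.IsTree :=
    (SimpleGraph.Iso.comap (maxCliqueEquiv e) T).isTree_iff
  simp only [IsCliqueTree, (comap_maxCliqueEquiv_surjective e).forall, comap_le_cliqueGraph_iff,
    hT, weight_comap]

lemma mem_leafCliques_image_iff {K : Set V} : e '' K ∈ leafCliques G' ↔ K ∈ leafCliques G := by
  simp only [leafCliques, Set.mem_ofPred_eq, (comap_maxCliqueEquiv_surjective e).exists,
    isCliqueTree_comap_iff, isMaxClique_image_iff, (maxCliqueEquiv e).surjective.forall,
    SimpleGraph.comap_adj, EmbeddingLike.apply_eq_iff_eq]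
  exact Iff.rfl

lemma mem_simplicial_iff {v : V} : e v ∈ simplicial G' ↔ v ∈ simplicial G := by
  rw [simplicial, simplicial, Set.mem_ofPred_eq, Set.mem_ofPred_eq, ← isClique_image_iff e]
  congr! 1
  ext x
  obtain ⟨x, rfl⟩ := e.surjective x
  simp [e.map_adj_iff]

lemma image_simplicial : e '' simplicial G = simplicial G' := by
  ext x
  obtain ⟨x, rfl⟩ := e.surjective x
  rw [e.injective.mem_set_image, mem_simplicial_iff]

lemma Separates.image {S P Q : Set V} (h : Separates G S P Q) :
    Separates G' (e '' S) (e '' P) (e '' Q) := by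
  rw [Separates, ← Set.image_sdiff e.injective, ← Set.image_sdiff e.injective]
  rintro _ ⟨p, hp, rfl⟩ _ ⟨q, hq, rfl⟩ W
  obtain ⟨x, hx, hxS⟩ := h p hp q hq
    ((W.map e.symm.toHom).copy (e.symm_apply_apply p) (e.symm_apply_apply q))
  refine ⟨e x, ?_, x, hxS, rfl⟩
  simp only [SimpleGraph.Walk.support_copy, SimpleGraph.Walk.support_map, List.mem_map] at hx
  obtain ⟨y, hy, rfl⟩ := hx
  simpa using hy

lemma image_symm_image (A : Set V) : e.symm '' (e '' A) = A :=
  e.toEquiv.symm_image_image A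

lemma separates_image_iff {S P Q : Set V} :
    Separates G' (e '' S) (e '' P) (e '' Q) ↔ Separates G S P Q :=
  ⟨fun h => by simpa only [image_symm_image] using h.image e.symm, fun h => h.image e⟩

section Family

variable {𝓛 : Set (Set V)} {𝓛' : Set (Set V')} (h𝓛 : ∀ L, e '' L ∈ 𝓛' ↔ L ∈ 𝓛)
include h𝓛

/-- The family stays a parameter because the relations are needed relative to `leafCliques` and
relative to `leaf0`. -/
lemma precBy_image_iff {A B C : Set V} :
    PrecBy G' 𝓛' (e '' A) (e '' B) (e '' C) ↔ PrecBy G 𝓛 A B C := by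
  simp only [PrecBy, h𝓛, separates_image_iff, ne_eq, iso_image_inj]

lemma prec_image_iff {A B : Set V} : Prec G' 𝓛' (e '' A) (e '' B) ↔ Prec G 𝓛 A B := by
  simp only [Prec, (iso_image_surjective e).exists, precBy_image_iff e h𝓛]

lemma approx_image_iff {A B : Set V} : Approx G' 𝓛' (e '' A) (e '' B) ↔ Approx G 𝓛 A B := by
  simp only [Approx, (iso_image_surjective e).exists, precBy_image_iff e h𝓛]

end Family

lemma mem_leaf0_image_iff (L : Set V) : e '' L ∈ leaf0 G' ↔ L ∈ leaf0 G := by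
  simp only [leaf0, StrictPrec, Set.mem_ofPred_eq, (iso_image_surjective e).forall,
    mem_leafCliques_image_iff, prec_image_iff e fun _ => mem_leafCliques_image_iff e]

lemma mem_leaf1_image_iff (L : Set V) : e '' L ∈ leaf1 G' ↔ L ∈ leaf1 G := by
  simp only [leaf1, Set.mem_ofPred_eq, (iso_image_surjective e).forall, ne_eq, iso_image_inj,
    mem_leaf0_image_iff, approx_image_iff e (mem_leaf0_image_iff e)]

lemma isJointSeparator_image_iff {L₁ L₂ Z : Set V} :
    IsJointSeparator G' (e '' L₁) (e '' L₂) (e '' Z) ↔ IsJointSeparator G L₁ L₂ Z := by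
  simp only [IsJointSeparator, (iso_image_surjective e).exists, ne_eq, iso_image_inj,
    mem_leaf0_image_iff, ← Set.image_inter e.injective, iso_image_subset,
    ← Set.image_symmDiff e.injective, separates_image_iff]

lemma mem_separators_image_iff (Z : Set V) : e '' Z ∈ separators G' ↔ Z ∈ separators G := by
  rw [separators, separators, Set.mem_ofPred_eq, Set.mem_ofPred_eq]
  refine minimal_image_iff e (fun Z => ?_) Z
  simp only [(iso_image_surjective e).exists, ne_eq, iso_image_inj, mem_leaf0_image_iff,
    isJointSeparator_image_iff, approx_image_iff e (mem_leaf0_image_iff e)]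

lemma sUnion_image_family {𝓕 : Set (Set V)} {𝓕' : Set (Set V')}
    (h : ∀ S, e '' S ∈ 𝓕' ↔ S ∈ 𝓕) : ⋃₀ 𝓕' = e '' ⋃₀ 𝓕 := by
  ext x
  obtain ⟨x, rfl⟩ := e.surjective x
  simp only [Set.mem_sUnion, (iso_image_surjective e).exists, e.injective.mem_set_image, h]

lemma boundary_image (F : Set V) : boundary G' (e '' F) = e '' boundary G F := by
  ext x
  obtain ⟨x, rfl⟩ := e.surjective x
  simp only [boundary, Set.mem_ofPred_eq, e.injective.mem_set_image, e.surjective.exists,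
    e.map_adj_iff]

/-- An isomorphism restricts to isomorphisms of induced subgraphs. -/
noncomputable def induceIso {A : Set V} {A' : Set V'} (h : A' = e '' A) :
    G.induce A ≃g G'.induce A' where
  toEquiv := (e.toEquiv.image A).trans (Equiv.setCongr h.symm)
  map_rel_iff' := e.map_adj_iff

lemma induceIso_val {A : Set V} {A' : Set V'} (h : A' = e '' A) (x : A) :
    (induceIso e h x : V') = e x := rfl

lemma isComponent_image_iff {U F : Set V} :
    IsComponent G' (e '' U) (e '' F) ↔ IsComponent G U F := by
  simp only [IsComponent, boundary_image, iso_image_subset, Set.disjoint_image_iff e.injective,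
    (induceIso e (A := F) rfl).connected_iff]

lemma mem_comp0_image_iff (F : Set V) : e '' F ∈ comp0 G' ↔ F ∈ comp0 G := by
  simp only [comp0, Set.mem_ofPred_eq, sUnion_image_family e (mem_separators_image_iff e),
    isComponent_image_iff, boundary_image, mem_separators_image_iff]

lemma isFull_image_iff {F : Set V} : IsFull G' (e '' F) ↔ IsFull G F := by
  simp only [IsFull, boundary_image, Set.forall_mem_image, e.map_adj_iff]

lemma mem_comp0'_image_iff (F : Set V) : e '' F ∈ comp0' G' ↔ F ∈ comp0' G := by
  have h (Z : Set V) : ⋃₀ {F' | F' ∈ comp0 G' ∧ boundary G' F' = e '' Z ∧ IsFull G' F'} =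
      e '' ⋃₀ {F' | F' ∈ comp0 G ∧ boundary G F' = Z ∧ IsFull G F'} :=
    sUnion_image_family e fun S => by
      simp only [Set.mem_ofPred_eq, mem_comp0_image_iff, boundary_image, iso_image_inj,
        isFull_image_iff]
  simp only [comp0', Set.mem_union, Set.mem_ofPred_eq, (iso_image_surjective e).exists, h,
    iso_image_inj, mem_comp0_image_iff, boundary_image, isFull_image_iff,
    mem_separators_image_iff]

/-- An isomorphism induces isomorphisms of completions. -/
noncomputable def completionIso {F Z : Set V} {F' Z' : Set V'} (hF : F' = e '' F)
    (hZ : Z' = e '' Z) : completion G F Z ≃g completion G' F' Z' where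
  toEquiv := Equiv.sumCongr ((e.toEquiv.image (F ∪ Z)).trans
    (Equiv.setCongr (by rw [hF, hZ, ← Set.image_union]; rfl))) (Equiv.refl Bool)
  map_rel_iff' := by
    subst hF hZ
    rintro (a | a) (b | b)
    · exact e.map_adj_iff
    · exact and_congr_left' e.injective.mem_set_image
    · exact and_congr_left' e.injective.mem_set_image
    · exact Iff.rfl

lemma completionIso_image_inCompletion {F Z : Set V} {F' Z' : Set V'} (hF : F' = e '' F)
    (hZ : Z' = e '' Z) (A : Set V) :
    completionIso e hF hZ '' inCompletion F Z A = inCompletion F' Z' (e '' A) := by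
  subst hF hZ
  ext x
  constructor
  · rintro ⟨_, ⟨v, rfl, hv⟩, rfl⟩
    exact ⟨_, rfl, v, hv, rfl⟩
  · rintro ⟨⟨_, hv'⟩, rfl, v, hv, rfl⟩
    rw [← Set.image_union, e.injective.mem_set_image] at hv'
    exact ⟨Sum.inl ⟨v, hv'⟩, ⟨_, rfl, hv⟩, rfl⟩

include e in
lemma isIntervalGraph_of_iso (h : IsIntervalGraph G) : IsIntervalGraph G' := by
  obtain ⟨a, b, hab, h⟩ := h
  refine ⟨a ∘ e.symm, b ∘ e.symm, fun v => hab _, fun u v huv => ?_⟩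
  rw [← e.symm.map_adj_iff]
  exact h _ _ (e.symm.injective.ne huv)

include e in
lemma isIntervalGraph_iff_of_iso : IsIntervalGraph G ↔ IsIntervalGraph G' :=
  ⟨isIntervalGraph_of_iso e, isIntervalGraph_of_iso e.symm⟩

lemma mem_comp1_image_iff (F : Set V) : e '' F ∈ comp1 G' ↔ F ∈ comp1 G := by
  simp only [comp1, Set.mem_ofPred_eq, mem_comp0'_image_iff,
    isIntervalGraph_iff_of_iso (completionIso e (F := F) rfl (boundary_image e F))]

lemma eq_empty_iff_of_image {𝓕 : Set (Set V)} {𝓕' : Set (Set V')}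
    (h : ∀ S, e '' S ∈ 𝓕' ↔ S ∈ 𝓕) : 𝓕' = ∅ ↔ 𝓕 = ∅ := by
  simp only [Set.eq_empty_iff_forall_notMem, (iso_image_surjective e).forall, h]

end Transport

/-- The extraction procedure is deterministic and commutes with isomorphisms. -/
lemma Extract.mem_image_iff {V : Type u} {G : SimpleGraph V} {𝓕 : Set (Set V)}
    (h : Extract G 𝓕) : ∀ {V' : Type w} {G' : SimpleGraph V'} {𝓕' : Set (Set V')},
      Extract G' 𝓕' → ∀ (e : G ≃g G') (X : Set V), e '' X ∈ 𝓕' ↔ X ∈ 𝓕 := by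
  induction h with
  | @simplicial V G h1 =>
    intro V' G' 𝓕' h' e X
    -- The conditions selecting the branch are invariant, so both runs are in the same case.
    have h1' := mt (eq_empty_iff_of_image e (mem_leaf1_image_iff e)).1 h1.ne_empty
    cases h' with
    | simplicial _ h3 =>
      simp only [Set.mem_ofPred_eq, Set.image_nonempty, (iso_image_surjective e).exists,
        mem_leaf1_image_iff, ← image_simplicial e, ← Set.image_inter e.injective, iso_image_inj]
    | interval _ h3 h4 => exact absurd h3 h1'
    | recurse _ h3 h4 S' hS' => exact absurd h3 h1'
  | @interval V G h1 h2 =>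
    intro V' G' 𝓕' h' e X
    have h1' := (eq_empty_iff_of_image e (mem_leaf1_image_iff e)).2 h1
    have h2' := mt (eq_empty_iff_of_image e (mem_comp1_image_iff e)).1 h2.ne_empty
    cases h' with
    | simplicial _ h3 => exact absurd h1' h3.ne_empty
    | interval _ h3 h4 => exact mem_comp1_image_iff e X
    | recurse _ h3 h4 S' hS' => exact absurd h4 h2'
  | @recurse V G h1 h2 S hS ih =>
    intro V' G' 𝓕' h' e X
    have h1' := (eq_empty_iff_of_image e (mem_leaf1_image_iff e)).2 h1
    have h2' := (eq_empty_iff_of_image e (mem_comp1_image_iff e)).2 h2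
    cases h' with
    | simplicial _ h3 => exact absurd h1' h3.ne_empty
    | interval _ h3 h4 => exact absurd h2' h4.ne_empty
    | recurse _ h3 h4 S' hS' =>
      simp only [Set.mem_ofPred_eq, (iso_image_surjective e).exists, mem_comp0'_image_iff,
        iso_image_subset]
      refine exists_congr fun F => and_congr_right fun hF => and_congr_right fun _ => ?_
      -- The induction hypothesis is applied to the isomorphism that `e` induces between
      -- completions, which is why the target graph and `e` are quantified after the induction
      -- variable.
      rw [← ih F hF (hS' _ ((mem_comp0'_image_iff e F).2 hF))
        (completionIso e rfl (boundary_image e F)), completionIso_image_inCompletion]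

section Canonical

variable {V : Type u} {V' : Type w} {G : SimpleGraph V} {G' : SimpleGraph V'} {ℓ : ℕ}
  {𝓧 : Fin ℓ → Set (Set V)} {𝓧' : Fin ℓ → Set (Set V')}

/-- Canonical decompositions are unique and commute with isomorphisms. -/
lemma IsCanonicalDecomposition.mem_image_iff (h : IsCanonicalDecomposition G 𝓧)
    (h' : IsCanonicalDecomposition G' 𝓧') (e : G ≃g G') (i : Fin ℓ) :
    ∀ X : Set V, e '' X ∈ 𝓧' i ↔ X ∈ 𝓧 i := by
  induction i using WellFoundedLT.induction with | _ i ih =>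
  -- What remains at level `i` depends on the earlier levels only.
  have hR : remaining 𝓧' i = e '' remaining 𝓧 i := by
    ext v
    obtain ⟨v, rfl⟩ := e.surjective v
    rw [e.injective.mem_set_image]
    refine forall₂_congr fun j hj => ?_
    simp only [(iso_image_surjective e).forall, ih j hj, e.injective.mem_set_image]
  have hI := isIntervalGraph_iff_of_iso (induceIso e hR)
  intro X
  by_cases hi : i.1 = 0 ∨ ¬ IsIntervalGraph (G.induce (remaining 𝓧 i))
  · obtain ⟨𝓕, hF, hX⟩ := h.extract i hi
    obtain ⟨𝓕', hF', hX'⟩ := h'.extract i (by rwa [← hI])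
    have himg (F : Set (remaining 𝓧 i)) :
        Subtype.val '' (induceIso e hR '' F) = e '' (Subtype.val '' F) := by
      simp only [Set.image_image, induceIso_val]
    simp only [hX, hX', Set.mem_ofPred_eq, (iso_image_surjective (induceIso e hR)).exists,
      hF.mem_image_iff hF' (induceIso e hR), himg, iso_image_inj]
  · rw [not_or, not_not] at hi
    rw [(h.last i hi.1 hi.2).2, (h'.last i hi.1 (hI.1 hi.2)).2, Set.mem_singleton_iff,
      Set.mem_singleton_iff, hR, iso_image_inj]

end Canonical

/-! ### Fragments of an extraction -/

section Structure

variable {V : Type u} {G : SimpleGraph V}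

/-- A property that spreads along the edges inside a connected set holds on all of it. -/
lemma forall_of_connected_induce {F : Set V} (hF : (G.induce F).Connected) {P : V → Prop}
    (hP : ∀ x ∈ F, ∀ y ∈ F, G.Adj x y → P x → P y) {v : V} (hv : v ∈ F) (hPv : P v) :
    ∀ x ∈ F, P x := by
  intro x hx
  obtain ⟨W⟩ := hF.preconnected ⟨v, hv⟩ ⟨x, hx⟩
  have key : ∀ {a b : F} (_ : (G.induce F).Walk a b), P a → P b := by
    intro a b W
    induction W with
    | nil => exact id
    | cons h _ ih => exact fun ha => ih (hP _ (Subtype.prop _) _ (Subtype.prop _) h ha)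
  exact key W hPv

/-- An edge of `F` leaving `F'` would end in the boundary of `F'`, hence in `U`, which `F` avoids.
-/
lemma IsComponent.subset_of_mem {U F F' : Set V} (hF : IsComponent G U F)
    (hF' : IsComponent G U F') {v : V} (hv : v ∈ F) (hv' : v ∈ F') : F ⊆ F' := by
  refine forall_of_connected_induce hF.2.1 (P := (· ∈ F')) (fun x _ y hy h hx => ?_) hv hv'
  by_contra hyF'
  exact Set.disjoint_left.1 hF.1 hy (hF'.2.2 ⟨hyF', x, hx, h⟩)

lemma IsComponent.eq_of_mem {U F F' : Set V} (hF : IsComponent G U F)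
    (hF' : IsComponent G U F') {v w : V} (hv : v ∈ F) (hw : w ∈ F') (h : v = w ∨ G.Adj v w) :
    F = F' := by
  have hwF : w ∈ F := by
    rcases h with rfl | h
    · exact hv
    · by_contra hwF
      exact Set.disjoint_left.1 hF'.1 hw (hF.2.2 ⟨hwF, v, hv, h⟩)
  exact (hF.subset_of_mem hF' hwF hw).antisymm (hF'.subset_of_mem hF hw hwF)

/-- The members of `𝓕` are pairwise disjoint and there are no edges between them. -/
def IsSeparated (G : SimpleGraph V) (𝓕 : Set (Set V)) : Prop :=
  ∀ X ∈ 𝓕, ∀ Y ∈ 𝓕, ∀ v ∈ X, ∀ w ∈ Y, v = w ∨ G.Adj v w → X = Y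

/-- The neighbourhoods outside of `X` of the vertices of `X` form a chain. -/
def IsNested (G : SimpleGraph V) (X : Set V) : Prop :=
  ∀ v ∈ X, ∀ w ∈ X, G.neighborSet v \ X ⊆ G.neighborSet w ∨ G.neighborSet w \ X ⊆ G.neighborSet v

/-- Any component inside `F` determines `F`, which reduces separatedness of `comp0'` to that of
components. -/
lemma exists_comp0_of_mem_comp0' {F : Set V} (hF : F ∈ comp0' G) {v : V} (hv : v ∈ F) :
    ∃ C ∈ comp0 G, v ∈ C ∧ (¬ IsFull G C ∧ F = C ∨ IsFull G C ∧
      F = ⋃₀ {F' | F' ∈ comp0 G ∧ boundary G F' = boundary G C ∧ IsFull G F'}) := by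
  rcases hF with ⟨hF, hfull⟩ | ⟨Z, hZ, -, rfl⟩
  · exact ⟨F, hF, hv, Or.inl ⟨hfull, rfl⟩⟩
  · obtain ⟨C, ⟨hC, rfl, hfull⟩, hvC⟩ := hv
    exact ⟨C, hC, hvC, Or.inr ⟨hfull, rfl⟩⟩

lemma isSeparated_comp0' : IsSeparated G (comp0' G) := by
  intro F hF F' hF' v hv w hw h
  obtain ⟨C, hC, hvC, hFC⟩ := exists_comp0_of_mem_comp0' hF hv
  obtain ⟨C', hC', hwC', hFC'⟩ := exists_comp0_of_mem_comp0' hF' hw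
  obtain rfl := hC.1.eq_of_mem hC'.1 hvC hwC' h
  rcases hFC with ⟨h1, rfl⟩ | ⟨h1, rfl⟩ <;> rcases hFC' with ⟨h2, h3⟩ | ⟨h2, h3⟩
  · exact h3.symm
  · exact absurd h2 h1
  · exact absurd h1 h2
  · exact h3.symm

lemma IsIntervalGraph.exists_adj_iff (h : IsIntervalGraph G) :
    ∃ a b : V → ℝ, (∀ v, a v ≤ b v) ∧ ∀ u v, u ≠ v → (G.Adj u v ↔ a u ≤ b v ∧ a v ≤ b u) := by
  obtain ⟨a, b, hab, h⟩ := h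
  refine ⟨a, b, hab, fun u v huv => (h u v huv).trans ?_⟩
  rw [Set.Icc_inter_Icc, Set.nonempty_Icc, sup_le_iff, le_inf_iff, le_inf_iff]
  have := hab u
  have := hab v
  tauto

/-- A connected set of vertices whose completion is an interval graph is nested. -/
lemma isNested_of_isIntervalGraph {F : Set V} (hF : (G.induce F).Connected)
    (hI : IsIntervalGraph (completion G F (boundary G F))) : IsNested G F := by
  obtain ⟨a', b', hab', h⟩ := hI.exists_adj_iff
  intro v hv w hw
  by_contra! hcon
  obtain ⟨hvw, hwv⟩ := hcon
  obtain ⟨x, ⟨hvx, hxF⟩, hwx⟩ := Set.not_subset.1 hvw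
  obtain ⟨y, ⟨hwy, hyF⟩, hvy⟩ := Set.not_subset.1 hwv
  simp only [SimpleGraph.mem_neighborSet] at hvx hwx hwy hvy
  have hxB : x ∈ boundary G F := ⟨hxF, v, hv, hvx⟩
  have hyB : y ∈ boundary G F := ⟨hyF, w, hw, hwy⟩
  have hadj {p q : V} (hp : p ∈ F ∪ boundary G F) (hq : q ∈ F ∪ boundary G F) (hpq : p ≠ q) :
      G.Adj p q ↔ a' (Sum.inl ⟨p, hp⟩) ≤ b' (Sum.inl ⟨q, hq⟩) ∧
        a' (Sum.inl ⟨q, hq⟩) ≤ b' (Sum.inl ⟨p, hp⟩) :=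
    h (Sum.inl ⟨p, hp⟩) (Sum.inl ⟨q, hq⟩) (by simpa using hpq)
  -- No vertex of `F` is adjacent to `l`, so its interval lies strictly left or strictly right of
  -- that of `l`.
  have hside {p : V} (hp : p ∈ F) : b' (Sum.inl ⟨p, Or.inl hp⟩) < a' (Sum.inr false) ∨
      b' (Sum.inr false) < a' (Sum.inl ⟨p, Or.inl hp⟩) := by
    by_contra! hc
    exact ((h (Sum.inr false) (Sum.inl ⟨p, Or.inl hp⟩) (by simp)).2 hc).1.1 hp
  have hZ {z : V} (hz : z ∈ boundary G F) := (h (Sum.inr false) (Sum.inl ⟨z, Or.inr hz⟩)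
    (by simp)).1 ⟨hz, rfl⟩
  have hl := hab' (Sum.inr false)
  obtain ⟨hx1, hx2⟩ := hZ hxB
  obtain ⟨hy1, hy2⟩ := hZ hyB
  have hv0 := hab' (Sum.inl ⟨v, Or.inl hv⟩)
  have hw0 := hab' (Sum.inl ⟨w, Or.inl hw⟩)
  obtain ⟨hvx1, hvx2⟩ := (hadj (Or.inl hv) (Or.inr hxB) hvx.ne).1 hvx
  obtain ⟨hwy1, hwy2⟩ := (hadj (Or.inl hw) (Or.inr hyB) hwy.ne).1 hwy
  rw [hadj (Or.inl hw) (Or.inr hxB) (by rintro rfl; exact hxF hw), not_and_or, not_le,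
    not_le] at hwx
  rw [hadj (Or.inl hv) (Or.inr hyB) (by rintro rfl; exact hyF hv), not_and_or, not_le,
    not_le] at hvy
  -- Adjacent vertices of `F` are on the same side of `l`; by connectedness so is all of `F`.
  have hsame : b' (Sum.inr false) < a' (Sum.inl ⟨v, Or.inl hv⟩) ↔
      b' (Sum.inr false) < a' (Sum.inl ⟨w, Or.inl hw⟩) := by
    have hstep {p q : V} (hp : p ∈ F) (hq : q ∈ F) (hpq : G.Adj p q)
        (h1 : b' (Sum.inr false) < a' (Sum.inl ⟨p, Or.inl hp⟩)) :
        b' (Sum.inr false) < a' (Sum.inl ⟨q, Or.inl hq⟩) := by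
      have h2 := (hadj (Or.inl hp) (Or.inl hq) hpq.ne).1 hpq
      rcases hside hq with h3 | h3
      · linarith
      · exact h3
    have hall {p q : V} (hp : p ∈ F) (hq : q ∈ F) :
        b' (Sum.inr false) < a' (Sum.inl ⟨p, Or.inl hp⟩) →
        b' (Sum.inr false) < a' (Sum.inl ⟨q, Or.inl hq⟩) := fun h1 =>
      (forall_of_connected_induce hF
        (P := fun r => ∃ hr : r ∈ F, b' (Sum.inr false) < a' (Sum.inl ⟨r, Or.inl hr⟩))
        (fun r _ s hs hrs ⟨hr, h2⟩ => ⟨hs, hstep hr hs hrs h2⟩) hp ⟨hp, h1⟩ q hq).2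
    exact ⟨hall hv hw, hall hw hv⟩
  rcases hside hv with h1 | h1 <;> rcases hside hw with h2 | h2
  -- Separator intervals meet that of `l`. Hence, left of `l`, `p` is adjacent to `z` iff the left
  -- end of `z` is at most the right end of `p`; `x` and `y` would order the right ends of `v` and
  -- `w` in opposite ways.
  · rcases hwx with h3 | h3 <;> rcases hvy with h4 | h4 <;> linarith
  · linarith [hsame.2 h2]
  · linarith [hsame.1 h1]
  · rcases hwx with h3 | h3 <;> rcases hvy with h4 | h4 <;> linarith

/-- A union of full components may be disconnected, but its vertices have all their outside
neighbours in `Z` and are adjacent to the whole of `Z`. -/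
lemma isNested_of_mem_comp1 {F : Set V} (hF : F ∈ comp1 G) : IsNested G F := by
  obtain ⟨hF | ⟨Z, hZ, -, rfl⟩, hI⟩ := hF
  · exact isNested_of_isIntervalGraph hF.1.1.2.1 hI
  · rintro v hv w ⟨D, ⟨hD, hDZ, hDfull⟩, hwD⟩
    refine Or.inl fun x ⟨hvx, hx⟩ => ?_
    obtain ⟨C, ⟨hC, hCZ, hCfull⟩, hvC⟩ := id hv
    have hxZ : x ∈ Z := by
      rw [← hCZ]
      exact ⟨fun hxC => hx ⟨C, ⟨hC, hCZ, hCfull⟩, hxC⟩, v, hvC, hvx⟩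
    exact hDfull w hwD x (hDZ ▸ hxZ)

/-- The closed neighbourhood of a simplicial vertex is a clique, hence the only maximal clique
through it. -/
lemma IsMaxClique.mem_iff_of_simplicial {L : Set V} (hL : IsMaxClique G L) {v : V} (hv : v ∈ L)
    (hs : v ∈ simplicial G) (x : V) : x ∈ L ↔ v = x ∨ G.Adj v x := by
  refine ⟨fun hx => or_iff_not_imp_left.2 fun hne => hL.1 hv hx hne, fun hx => ?_⟩
  have hclique : G.IsClique (insert v (G.neighborSet v)) :=
    SimpleGraph.IsClique.insert hs fun b hb _ => hb
  refine hL.2 hclique (fun y hy => ?_) (hx.imp Eq.symm id)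
  by_cases hne : v = y
  · exact Or.inl hne.symm
  · exact Or.inr (hL.1 hv hy hne)

lemma isMaxClique_of_mem_leaf1 {L : Set V} (hL : L ∈ leaf1 G) : IsMaxClique G L :=
  hL.1.1.1

/-- Different fragments of an extraction are disjoint and there are no edges between them. -/
lemma Extract.isSeparated {𝓕 : Set (Set V)} (h : Extract G 𝓕) : IsSeparated G 𝓕 := by
  induction h with
  | simplicial G h1 =>
    rintro _ ⟨-, L, hL, rfl⟩ _ ⟨-, L', hL', rfl⟩ v hv w hw hvw
    replace hL := isMaxClique_of_mem_leaf1 hL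
    replace hL' := isMaxClique_of_mem_leaf1 hL'
    have hwL : w ∈ L := (hL.mem_iff_of_simplicial hv.1 hv.2 w).2 hvw
    -- Both cliques are the closed neighbourhood of `w`.
    have : L = L' := Set.ext fun x => by
      rw [hL.mem_iff_of_simplicial hwL hw.2, hL'.mem_iff_of_simplicial hw.1 hw.2]
    rw [this]
  | interval G h1 h2 => exact fun F hF F' hF' => isSeparated_comp0' F hF.1 F' hF'.1
  | @recurse V G h1 h2 S hS ih =>
    rintro X ⟨F, hF, hXF, hXS⟩ Y ⟨F', hF', hYF', hYS⟩ v hv w hw hvw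
    obtain rfl := isSeparated_comp0' F hF F' hF' v (hXF hv) w (hYF' hw) hvw
    have heq := ih F hF _ hXS _ hYS (Sum.inl ⟨v, Or.inl (hXF hv)⟩) ⟨_, rfl, hv⟩
      (Sum.inl ⟨w, Or.inl (hYF' hw)⟩) ⟨_, rfl, hw⟩
      (hvw.imp (fun h => by subst h; rfl) id)
    have hmem {A : Set V} {x : V} (hx : x ∈ F) :
        Sum.inl ⟨x, Or.inl hx⟩ ∈ inCompletion F (boundary G F) A ↔ x ∈ A := by
      constructor
      · rintro ⟨y, hy, hyA⟩
        cases hy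
        exact hyA
      · exact fun h => ⟨_, rfl, h⟩
    ext x
    constructor
    · exact fun hx => (hmem (hXF hx)).1 (heq ▸ (hmem (hXF hx)).2 hx)
    · exact fun hx => (hmem (hYF' hx)).1 (heq ▸ (hmem (hYF' hx)).2 hx)

/-- The fragments of an extraction are nested. -/
lemma Extract.isNested {𝓕 : Set (Set V)} (h : Extract G 𝓕) : ∀ X ∈ 𝓕, IsNested G X := by
  induction h with
  | simplicial G h1 =>
    rintro _ ⟨-, L, hL, rfl⟩ v hv w hw
    replace hL := isMaxClique_of_mem_leaf1 hL
    refine Or.inl fun x ⟨hvx, hx⟩ => ?_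
    have hxL := (hL.mem_iff_of_simplicial hv.1 hv.2 x).2 (Or.inr hvx)
    refine ((hL.mem_iff_of_simplicial hw.1 hw.2 x).1 hxL).resolve_left ?_
    rintro rfl
    exact hx hw
  | interval G h1 h2 => exact fun X => isNested_of_mem_comp1
  | @recurse V G h1 h2 S hS ih =>
    rintro X ⟨F, hF, hXF, hXS⟩ v hv w hw
    -- Neighbours of vertices of `F` lie in `F ∪ boundary G F`, so the completion sees all of them.
    have key {p q : V} (hp : p ∈ X) (hq : q ∈ X)
        (h : (completion G F (boundary G F)).neighborSet (Sum.inl ⟨p, Or.inl (hXF hp)⟩) \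
          inCompletion F (boundary G F) X ⊆
            (completion G F (boundary G F)).neighborSet (Sum.inl ⟨q, Or.inl (hXF hq)⟩)) :
        G.neighborSet p \ X ⊆ G.neighborSet q := by
      rintro x ⟨hpx, hx⟩
      have hxF : x ∈ F ∪ boundary G F := by
        by_cases hxF : x ∈ F
        · exact Or.inl hxF
        · exact Or.inr ⟨hxF, p, hXF hp, hpx⟩
      refine @h (Sum.inl ⟨x, hxF⟩) ⟨hpx, ?_⟩
      rintro ⟨y, hy, hyX⟩
      cases hy
      exact hx hyX
    exact (ih F hF _ hXS (Sum.inl ⟨v, Or.inl (hXF hv)⟩) ⟨_, rfl, hv⟩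
      (Sum.inl ⟨w, Or.inl (hXF hw)⟩) ⟨_, rfl, hw⟩).imp (key hv hw) (key hw hv)

end Structure

/-! ### Layered decompositions -/

section Layered

variable {V : Type u} {ℓ : ℕ}

/-- The structure of canonical decompositions used for lifting automorphisms: fragments partition
the vertices, those of one level are pairwise nonadjacent, and the neighbourhoods of the vertices
of a fragment in the higher levels form a chain. -/
structure IsLayered (H : SimpleGraph V) (𝓧 : Fin ℓ → Set (Set V)) : Prop where
  cover : ∀ v : V, ∃ i, ∃ X ∈ 𝓧 i, v ∈ X
  level_unique : ∀ i j, ∀ X ∈ 𝓧 i, ∀ Y ∈ 𝓧 j, ∀ v ∈ X, v ∈ Y → i = j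
  separated : ∀ i, IsSeparated H (𝓧 i)
  nested : ∀ i, ∀ X ∈ 𝓧 i, ∀ v ∈ X, ∀ w ∈ X,
    H.neighborSet v ∩ above 𝓧 i ⊆ H.neighborSet w ∨ H.neighborSet w ∩ above 𝓧 i ⊆ H.neighborSet v

variable {G : SimpleGraph V} {𝓧 : Fin ℓ → Set (Set V)}

lemma IsCanonicalDecomposition.subset_remaining (h : IsCanonicalDecomposition G 𝓧) {i : Fin ℓ}
    {X : Set V} (hX : X ∈ 𝓧 i) : X ⊆ remaining 𝓧 i := by
  by_cases hi : i.1 = 0 ∨ ¬ IsIntervalGraph (G.induce (remaining 𝓧 i))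
  · obtain ⟨𝓕, -, hF⟩ := h.extract i hi
    rw [hF] at hX
    obtain ⟨F, -, rfl⟩ := hX
    exact Subtype.coe_image_subset _ _
  · rw [not_or, not_not] at hi
    rw [(h.last i hi.1 hi.2).2] at hX
    exact subset_of_eq hX

lemma IsCanonicalDecomposition.isLayered (h : IsCanonicalDecomposition G 𝓧) : IsLayered G 𝓧 := by
  have hlt {i j : Fin ℓ} {X Y : Set V} (hX : X ∈ 𝓧 i) (hY : Y ∈ 𝓧 j) {v : V} (hvX : v ∈ X)
      (hvY : v ∈ Y) : ¬ i < j := fun hij => h.subset_remaining hY hvY i hij X hX hvX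
  have habove {i : Fin ℓ} {v : V} (hv : v ∈ above 𝓧 i) : v ∈ remaining 𝓧 i := by
    obtain ⟨k, hik, X, hX, hvX⟩ := hv
    exact fun j hj => h.subset_remaining hX hvX j (hj.trans hik)
  refine ⟨h.exhausts, fun i j X hX Y hY v hvX hvY => ?_, fun i => ?_, fun i X hX => ?_⟩
  · exact le_antisymm (not_lt.1 (hlt hY hX hvY hvX)) (not_lt.1 (hlt hX hY hvX hvY))
  · by_cases hi : i.1 = 0 ∨ ¬ IsIntervalGraph (G.induce (remaining 𝓧 i))
    · obtain ⟨𝓕, h𝓕, hF⟩ := h.extract i hi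
      rw [hF]
      rintro _ ⟨F, hF, rfl⟩ _ ⟨F', hF', rfl⟩ _ ⟨v, hv, rfl⟩ _ ⟨w, hw, rfl⟩ hvw
      rw [h𝓕.isSeparated F hF F' hF' v hv w hw (hvw.imp Subtype.ext id)]
    · rw [not_or, not_not] at hi
      rw [(h.last i hi.1 hi.2).2]
      rintro X rfl Y rfl
      exact fun _ _ _ _ _ => rfl
  · by_cases hi : i.1 = 0 ∨ ¬ IsIntervalGraph (G.induce (remaining 𝓧 i))
    · obtain ⟨𝓕, h𝓕, hF⟩ := h.extract i hi
      obtain ⟨F, hFF, rfl⟩ := hF ▸ hX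
      rintro _ ⟨v, hv, rfl⟩ _ ⟨w, hw, rfl⟩
      -- Vertices of higher levels are still present when level `i` is extracted and lie outside
      -- `F`, so nestedness there gives the chain condition.
      have key {p q : remaining 𝓧 i} (hpq : (G.induce (remaining 𝓧 i)).neighborSet p \ F ⊆
          (G.induce (remaining 𝓧 i)).neighborSet q) :
          G.neighborSet p ∩ above 𝓧 i ⊆ G.neighborSet q := by
        rintro x ⟨hpx, hx⟩
        refine @hpq ⟨x, habove hx⟩ ⟨hpx, fun hxF => ?_⟩
        obtain ⟨k, hik, Y, hY, hxY⟩ := hx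
        exact hlt hX hY ⟨_, hxF, rfl⟩ hxY hik
      exact (h𝓕.isNested F hFF v hv w hw).imp key key
    · rw [not_or, not_not] at hi
      -- The last fragment is everything that remains, so nothing lies above it.
      intro v hv w hw
      refine Or.inl fun x ⟨_, hx⟩ => ?_
      have hxX : x ∈ X := by
        obtain rfl : X = remaining 𝓧 i := by rwa [(h.last i hi.1 hi.2).2] at hX
        exact habove hx
      obtain ⟨k, hik, Y, hY, hxY⟩ := hx
      exact absurd hik (hlt hX hY hxX hxY)

end Layered

/-! ### Disjoint unions of layered decompositions -/

section Combine

variable {V₁ : Type u} {V₂ : Type w} {ℓ : ℕ} {G₁ : SimpleGraph V₁} {G₂ : SimpleGraph V₂}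
  {𝓧₁ : Fin ℓ → Set (Set V₁)} {𝓧₂ : Fin ℓ → Set (Set V₂)}

lemma mem_above_combine_inl {i : Fin ℓ} {v : V₁} (h : Sum.inl v ∈ above (combine 𝓧₁ 𝓧₂) i) :
    v ∈ above 𝓧₁ i := by
  obtain ⟨k, hik, _, ⟨Y, hY, rfl⟩ | ⟨Y, hY, rfl⟩, hv⟩ := h
  · exact ⟨k, hik, Y, hY, Sum.inl_injective.mem_set_image.1 hv⟩
  · simp at hv

lemma mem_above_combine_inr {i : Fin ℓ} {v : V₂} (h : Sum.inr v ∈ above (combine 𝓧₁ 𝓧₂) i) :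
    v ∈ above 𝓧₂ i := by
  obtain ⟨k, hik, _, ⟨Y, hY, rfl⟩ | ⟨Y, hY, rfl⟩, hv⟩ := h
  · simp at hv
  · exact ⟨k, hik, Y, hY, Sum.inr_injective.mem_set_image.1 hv⟩

lemma IsLayered.combine (h₁ : IsLayered G₁ 𝓧₁) (h₂ : IsLayered G₂ 𝓧₂) :
    IsLayered (G₁ ⊕g G₂) (combine 𝓧₁ 𝓧₂) where
  cover := by
    rintro (v | v)
    · obtain ⟨i, X, hX, hv⟩ := h₁.cover v
      exact ⟨i, _, Or.inl ⟨X, hX, rfl⟩, v, hv, rfl⟩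
    · obtain ⟨i, X, hX, hv⟩ := h₂.cover v
      exact ⟨i, _, Or.inr ⟨X, hX, rfl⟩, v, hv, rfl⟩
  level_unique := by
    rintro i j _ (⟨X, hX, rfl⟩ | ⟨X, hX, rfl⟩) _ (⟨Y, hY, rfl⟩ | ⟨Y, hY, rfl⟩) _ ⟨v, hv, rfl⟩ hv'
    · exact h₁.level_unique i j X hX Y hY v hv (by simpa using hv')
    · simp at hv'
    · simp at hv'
    · exact h₂.level_unique i j X hX Y hY v hv (by simpa using hv')
  separated := by
    rintro i _ (⟨X, hX, rfl⟩ | ⟨X, hX, rfl⟩) _ (⟨Y, hY, rfl⟩ | ⟨Y, hY, rfl⟩) _ ⟨v, hv, rfl⟩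
      _ ⟨w, hw, rfl⟩ hvw
    · rw [h₁.separated i X hX Y hY v hv w hw (by simpa using hvw)]
    · simp at hvw
    · simp at hvw
    · rw [h₂.separated i X hX Y hY v hv w hw (by simpa using hvw)]
  nested := by
    rintro i _ (⟨X, hX, rfl⟩ | ⟨X, hX, rfl⟩) _ ⟨v, hv, rfl⟩ _ ⟨w, hw, rfl⟩
    · refine (h₁.nested i X hX v hv w hw).imp ?_ ?_ <;>
      · rintro hvw (x | x) ⟨hx, hxa⟩
        · exact (SimpleGraph.sum_adj_inl (H := G₂)).2
            (hvw ⟨(SimpleGraph.sum_adj_inl (H := G₂)).1 hx, mem_above_combine_inl hxa⟩)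
        · simp at hx
    · refine (h₂.nested i X hX v hv w hw).imp ?_ ?_ <;>
      · rintro hvw (x | x) ⟨hx, hxa⟩
        · simp at hx
        · exact (SimpleGraph.sum_adj_inr (G := G₁)).2
            (hvw ⟨(SimpleGraph.sum_adj_inr (G := G₁)).1 hx, mem_above_combine_inr hxa⟩)

end Combine

/-! ### Isomorphisms of completions -/

section CompletionIso

variable {V : Type u} {G : SimpleGraph V} {F Z F' Z' : Set V}

lemma inCompletion_subset_iff {A B : Set V} (hA : A ⊆ F ∪ Z) :
    inCompletion F Z A ⊆ inCompletion F Z B ↔ A ⊆ B := by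
  constructor
  · intro h x hx
    obtain ⟨v, hv, hvB⟩ := @h (Sum.inl ⟨x, hA hx⟩) ⟨_, rfl, hx⟩
    cases hv
    exact hvB
  · rintro h _ ⟨v, rfl, hv⟩
    exact ⟨v, rfl, h hv⟩

lemma mem_inCompletion_inl {A : Set V} (x : ↥(F ∪ Z)) :
    Sum.inl x ∈ inCompletion F Z A ↔ x.1 ∈ A := by
  constructor
  · rintro ⟨v, hv, hvA⟩
    cases hv
    exact hvA
  · exact fun h => ⟨_, rfl, h⟩

/-- The trace on the separator of the neighbourhood of a vertex, in terms of the completion. -/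
lemma inCompletion_neighborSet_inter (v : ↥(F ∪ Z)) :
    inCompletion F Z (G.neighborSet v ∩ Z) =
      {x | (completion G F Z).Adj (Sum.inl v) x ∧ (completion G F Z).Adj x (Sum.inr false) ∧
        x ≠ Sum.inr true} := by
  ext x
  rcases x with x | x
  · rw [mem_inCompletion_inl]
    simp [completion]
  · cases x <;> simp [completion, inCompletion]

/-- `l` is the only neighbour of the tail. -/
lemma iso_apply_inr_false {ι : completion G F Z ≃g completion G F' Z'}
    (hι : ι (Sum.inr true) = Sum.inr true) : ι (Sum.inr false) = Sum.inr false := by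
  have h : (completion G F' Z').Adj (ι (Sum.inr false)) (Sum.inr true) := by
    rw [← hι, ι.map_adj_iff]
    exact Bool.false_ne_true
  rcases hx : ι (Sum.inr false) with x | x <;> rw [hx] at h
  · exact absurd h.2 (by simp)
  · exact congrArg _ (Bool.eq_false_of_not_eq_true h)

/-- The trace consists of the common neighbours of the vertex and `l`, other than the tail, and `ι`
preserves both `l` and the tail. -/
lemma iso_image_inCompletion_neighborSet {ι : completion G F Z ≃g completion G F' Z'}
    (hι : ι (Sum.inr true) = Sum.inr true) {v : ↥(F ∪ Z)} {v' : ↥(F' ∪ Z')}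
    (hv : ι (Sum.inl v) = Sum.inl v') :
    ι '' inCompletion F Z (G.neighborSet v ∩ Z) = inCompletion F' Z' (G.neighborSet v' ∩ Z') := by
  ext x
  obtain ⟨x, rfl⟩ := ι.surjective x
  rw [ι.injective.mem_set_image, inCompletion_neighborSet_inter, inCompletion_neighborSet_inter,
    Set.mem_ofPred_eq, Set.mem_ofPred_eq, ← hv, ← hι, ← iso_apply_inr_false hι, ι.map_adj_iff,
    ι.map_adj_iff, ι.injective.ne_iff]

/-- A tail-preserving isomorphism of completions, as a map on the vertices of the graph. -/
lemma exists_map_of_completion_iso (hFZ : Disjoint F Z)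
    (ι : completion G F Z ≃g completion G F' Z') (hι : ι (Sum.inr true) = Sum.inr true) :
    ∃ f : V → V, (∀ x (hx : x ∈ F ∪ Z), ∃ h, ι (Sum.inl ⟨x, hx⟩) = Sum.inl ⟨f x, h⟩) ∧
      ∀ x ∈ F, f x ∈ F' := by
  have hl := iso_apply_inr_false hι
  have key (x : ↥(F ∪ Z)) : ∃ y : ↥(F' ∪ Z'), ι (Sum.inl x) = Sum.inl y := by
    rcases hx : ι (Sum.inl x) with y | (_ | _)
    · exact ⟨y, rfl⟩
    · exact absurd (ι.injective (hx.trans hl.symm)) (by simp)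
    · exact absurd (ι.injective (hx.trans hι.symm)) (by simp)
  choose g hg using key
  classical
  have hf (x : V) (hx : x ∈ F ∪ Z) :
      (if hx : x ∈ F ∪ Z then (g ⟨x, hx⟩ : V) else x) = g ⟨x, hx⟩ := dif_pos hx
  -- The value `x` outside `F ∪ Z` is arbitrary.
  refine ⟨fun x => if hx : x ∈ F ∪ Z then g ⟨x, hx⟩ else x, fun x hx => ?_, fun x hx => ?_⟩
  · simp only [hf x hx]
    exact ⟨(g ⟨x, hx⟩).2, hg _⟩
  · simp only [hf x (Or.inl hx)]
    -- An image in `Z'` would be adjacent to `l`, so `x` would be adjacent to `l` and lie in `Z`.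
    refine (g ⟨x, Or.inl hx⟩).2.resolve_right fun hz => ?_
    have h : (completion G F' Z').Adj (ι (Sum.inl ⟨x, Or.inl hx⟩)) (ι (Sum.inr false)) := by
      rw [hg, hl]
      exact ⟨hz, rfl⟩
    rw [ι.map_adj_iff] at h
    exact Set.disjoint_left.1 hFZ hx h.1

lemma image_eq_of_iso_image_inCompletion {ι : completion G F Z ≃g completion G F' Z'} {f : V → V}
    (hf : ∀ x (hx : x ∈ F ∪ Z), ∃ h, ι (Sum.inl ⟨x, hx⟩) = Sum.inl ⟨f x, h⟩) {A A' : Set V}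
    (hA : A ⊆ F ∪ Z) (hA' : A' ⊆ F' ∪ Z')
    (h : ι '' inCompletion F Z A = inCompletion F' Z' A') : f '' A = A' := by
  ext y
  constructor
  · rintro ⟨x, hx, rfl⟩
    obtain ⟨h', hfx⟩ := hf x (hA hx)
    rw [← mem_inCompletion_inl ⟨f x, h'⟩, ← h, ← hfx, ι.injective.mem_set_image]
    exact ⟨_, rfl, hx⟩
  · intro hy
    rw [← mem_inCompletion_inl ⟨y, hA' hy⟩, ← h] at hy
    obtain ⟨_, ⟨x, rfl, hx⟩, hxy⟩ := hy
    obtain ⟨h', hfx⟩ := hf x.1 x.2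
    refine ⟨x, hx, ?_⟩
    cases hfx.symm.trans hxy
    rfl

end CompletionIso

/-- An injective endomorphism of a finite graph is an automorphism. -/
noncomputable def isoOfInjective {V : Type u} [Finite V] {H : SimpleGraph V} (f : V → V)
    (hf : Function.Injective f) (hadj : ∀ v w, H.Adj v w → H.Adj (f v) (f w)) : H ≃g H where
  toEquiv := Equiv.ofBijective f (Finite.injective_iff_bijective.1 hf)
  map_rel_iff' := by
    intro v w
    refine ⟨fun h => ?_, hadj v w⟩
    -- The induced map on ordered adjacent pairs is injective on a finite set, hence onto, so every
    -- edge between images comes from an edge.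
    let g : {p : V × V // H.Adj p.1 p.2} → {p : V × V // H.Adj p.1 p.2} :=
      fun p => ⟨(f p.1.1, f p.1.2), hadj _ _ p.2⟩
    have hg : Function.Injective g := by
      rintro ⟨⟨a, b⟩, hab⟩ ⟨⟨c, d⟩, hcd⟩ h
      simp only [g, Subtype.mk.injEq, Prod.mk.injEq] at h
      obtain rfl := hf h.1
      obtain rfl := hf h.2
      rfl
    obtain ⟨⟨⟨a, b⟩, hab⟩, hg⟩ := Finite.injective_iff_surjective.1 hg ⟨(f v, f w), h⟩
    obtain ⟨h1, h2⟩ := Prod.ext_iff.1 (congrArg Subtype.val hg)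
    obtain rfl := hf h1
    obtain rfl := hf h2
    exact hab

/-! ### Automorphisms of layered decompositions -/

section Aut

variable {V : Type u} {ℓ : ℕ} {H : SimpleGraph V} {𝓧 : Fin ℓ → Set (Set V)}

lemma IsLayered.fragment_unique (hL : IsLayered H 𝓧) {i j : Fin ℓ} {X Y : Set V} (hX : X ∈ 𝓧 i)
    (hY : Y ∈ 𝓧 j) {v : V} (hvX : v ∈ X) (hvY : v ∈ Y) : X = Y := by
  obtain rfl := hL.level_unique i j X hX Y hY v hvX hvY
  exact hL.separated i X hX Y hY v hvX v hvY (Or.inl rfl)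

lemma IsLayered.disjoint_fragSep (hL : IsLayered H 𝓧) {i : Fin ℓ} {X : Set V} (hX : X ∈ 𝓧 i) :
    Disjoint X (fragSep H 𝓧 i X) := by
  rw [Set.disjoint_left]
  rintro v hv ⟨⟨k, hik, Y, hY, hvY⟩, -⟩
  exact hik.ne (hL.level_unique i k X hX Y hY v hv hvY)

/-- Attachment sets of a fragment are determined by their size. -/
lemma IsLayered.attachment_eq [Finite V] (hL : IsLayered H 𝓧) {i : Fin ℓ} {X : Set V}
    (hX : X ∈ 𝓧 i) {B C : Set V} (hB : B ∈ attachments H 𝓧 i X) (hC : C ∈ attachments H 𝓧 i X)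
    (hcard : (inPlus H 𝓧 i X B).ncard = (inPlus H 𝓧 i X C).ncard) : B = C := by
  obtain ⟨v, hv, rfl⟩ := hB
  obtain ⟨w, hw, rfl⟩ := hC
  have hsub (v : V) : H.neighborSet v ∩ fragSep H 𝓧 i X ⊆ X ∪ fragSep H 𝓧 i X :=
    Set.inter_subset_right.trans Set.subset_union_right
  -- Attachment sets are comparable, and comparable finite sets of equal size coincide.
  rcases hL.nested i X hX v hv w hw with h | h
  · have h' : H.neighborSet v ∩ fragSep H 𝓧 i X ⊆ H.neighborSet w ∩ fragSep H 𝓧 i X :=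
      fun x hx => ⟨h ⟨hx.1, hx.2.1⟩, hx.2⟩
    have heq := Set.eq_of_subset_of_ncard_le ((inCompletion_subset_iff (hsub v)).2 h') hcard.ge
    exact h'.antisymm ((inCompletion_subset_iff (hsub w)).1 heq.ge)
  · have h' : H.neighborSet w ∩ fragSep H 𝓧 i X ⊆ H.neighborSet v ∩ fragSep H 𝓧 i X :=
      fun x hx => ⟨h ⟨hx.1, hx.2.1⟩, hx.2⟩
    have heq := Set.eq_of_subset_of_ncard_le ((inCompletion_subset_iff (hsub w)).2 h') hcard.le
    exact ((inCompletion_subset_iff (hsub v)).1 heq.ge).antisymm h'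

/-- Every automorphism of a layered decomposition comes from a graph automorphism. -/
theorem IsLayered.exists_actsAs [Finite V] (hL : IsLayered H 𝓧)
    {ϱ : Equiv.Perm (Fragments 𝓧 ⊕ Terminals H 𝓧)} (hϱ : IsDecompAut H 𝓧 ϱ) :
    ∃ σ : H ≃g H, ActsAs H 𝓧 σ ϱ := by
  obtain ⟨hA1, hA2⟩ := hϱ
  choose lev hlev using fun X : Fragments 𝓧 => X.2
  choose r hr hrl ι htail hterm using fun X => hA1 (lev X) X (hlev X)
  choose f hf hfX using fun X =>
    exists_map_of_completion_iso (hL.disjoint_fragSep (hlev X)) (ι X) (htail X)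
  have hm (v : V) : ∃ X : Fragments 𝓧, v ∈ X.1 := by
    obtain ⟨i, X, hX, hv⟩ := hL.cover v
    exact ⟨⟨X, i, hX⟩, hv⟩
  choose m hm using hm
  have huniq {X Y : Fragments 𝓧} {v : V} (hvX : v ∈ X.1) (hvY : v ∈ Y.1) : X = Y :=
    Subtype.ext (hL.fragment_unique (hlev X) (hlev Y) hvX hvY)
  have hmX {X : Fragments 𝓧} {v : V} (hv : v ∈ X.1) : m v = X := huniq (hm v) hv
  have hr_inj {X Y : Fragments 𝓧} (h : r X = r Y) : X = Y :=
    Sum.inl_injective (ϱ.injective (by rw [hr, hr, h]))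
  have hf_inj {X : Fragments 𝓧} {v w : V} (hv : v ∈ X.1) (hw : w ∈ X.1) (h : f X v = f X w) :
      v = w := by
    obtain ⟨h1, h2⟩ := hf X v (Or.inl hv)
    obtain ⟨h3, h4⟩ := hf X w (Or.inl hw)
    have := (ι X).injective (h2.trans ((congrArg Sum.inl (Subtype.ext h)).trans h4.symm))
    cases this
    rfl
  have hfA {j : Fin ℓ} {X : Fragments 𝓧} (hj : j < lev X) {A : Terminals H 𝓧}
      (hA : A.1 ∈ terminalsIn H 𝓧 j X.1) :
      ∃ A' : Terminals H 𝓧, ϱ (Sum.inr A) = Sum.inr A' ∧ f X '' A.1 = A'.1 := by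
    obtain ⟨A', hϱA, hA', himg⟩ := hterm X j hj A hA
    have hsub {A X : Set V} (hA : A ∈ terminalsIn H 𝓧 j X) : A ⊆ X := by
      obtain ⟨-, Y, -, B, -, rfl⟩ := hA
      exact Set.inter_subset_right
    exact ⟨A', hϱA, image_eq_of_iso_image_inCompletion (hf X)
      ((hsub hA).trans Set.subset_union_left) ((hsub hA').trans Set.subset_union_left) himg⟩
  -- Each vertex is moved by the isomorphism chosen for its own fragment.
  let s : V → V := fun v => f (m v) v
  have hs {X : Fragments 𝓧} {v : V} (hv : v ∈ X.1) : s v = f X v := by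
    simp only [s, hmX hv]
  have hsr {X : Fragments 𝓧} {v : V} (hv : v ∈ X.1) : s v ∈ (r X).1 := by
    rw [hs hv]
    exact hfX X v hv
  have hs_inj : Function.Injective s := by
    intro v w h
    have hvw : m v = m w := hr_inj (huniq (hsr (hm v)) (h ▸ hsr (hm w)))
    have hw : w ∈ (m v).1 := hvw ▸ hm w
    exact hf_inj (hm v) hw (by rw [← hs (hm v), ← hs hw, h])
  have hlt {v w : V} (h : H.Adj v w) (hvw : lev (m v) < lev (m w)) : H.Adj (s v) (s w) := by
    set X := m v
    set Y := m w
    have hBX : H.neighborSet v ∩ fragSep H 𝓧 (lev X) X.1 ∈ attachments H 𝓧 (lev X) X.1 :=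
      ⟨v, hm v, rfl⟩
    set B := H.neighborSet v ∩ fragSep H 𝓧 (lev X) X.1
    have hwB : w ∈ B := ⟨h, ⟨_, hvw, _, hlev Y, hm w⟩, v, hm v, h⟩
    have hA : B ∩ Y.1 ∈ terminalsIn H 𝓧 (lev X) Y.1 :=
      ⟨⟨w, hwB, hm w⟩, X.1, hlev X, B, hBX, rfl⟩
    obtain ⟨X', A', hX', hA', B', hB', ⟨κ, -, hκ⟩, Y', -, hAY⟩ := hA2 _ _ hvw X
      ⟨B ∩ Y.1, _, _, hvw, _, hlev Y, hA⟩ (hlev X) ⟨_, hlev Y, hA⟩ B hBX ⟨Y.1, hlev Y, rfl⟩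
    obtain rfl : r X = X' := Sum.inl_injective ((hr X).symm.trans hX')
    obtain ⟨A'', hA'', himg⟩ := hfA hvw (A := ⟨B ∩ Y.1, _, _, hvw, _, hlev Y, hA⟩) hA
    obtain rfl : A'' = A' := Sum.inr_injective (hA''.symm.trans hA')
    obtain ⟨hv', hιv⟩ := hf X v (Or.inl (hm v))
    have hC : ι X '' inPlus H 𝓧 (lev X) X.1 B = inPlus H 𝓧 (lev X) (r X).1
        (H.neighborSet (f X v) ∩ fragSep H 𝓧 (lev X) (r X).1) :=
      iso_image_inCompletion_neighborSet (htail X) hιv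
    -- The isomorphism `κ` from (A2) need not be `ι X`, but both preserve sizes, and in `r X` the
    -- size determines the attachment set.
    have hBC : B' = H.neighborSet (f X v) ∩ fragSep H 𝓧 (lev X) (r X).1 := by
      refine hL.attachment_eq (hrl X) hB' ⟨f X v, hfX X v (hm v), rfl⟩ ?_
      rw [← hκ, ← hC, Set.ncard_image_of_injective _ κ.injective,
        Set.ncard_image_of_injective _ (ι X).injective]
    have hw' : f Y w ∈ B' ∩ Y' := by
      rw [← hAY, ← himg]
      exact ⟨w, ⟨hwB, hm w⟩, rfl⟩
    rw [hBC] at hw'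
    exact hw'.1.1
  have hadj (v w : V) (h : H.Adj v w) : H.Adj (s v) (s w) := by
    rcases lt_trichotomy (lev (m v)) (lev (m w)) with hvw | hvw | hvw
    · exact hlt h hvw
    · have hXY : m v = m w := Subtype.ext
        (hL.separated _ _ (hlev _) _ (hvw ▸ hlev _) v (hm v) w (hm w) (Or.inr h))
      have hw : w ∈ (m v).1 := hXY ▸ hm w
      rw [hs (hm v), hs hw]
      obtain ⟨hv1, hv2⟩ := hf (m v) v (Or.inl (hm v))
      obtain ⟨hw1, hw2⟩ := hf (m v) w (Or.inl hw)
      have h' : (plus H 𝓧 (lev (m v)) (m v).1).Adj (Sum.inl ⟨v, Or.inl (hm v)⟩)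
          (Sum.inl ⟨w, Or.inl hw⟩) := h
      rwa [← (ι (m v)).map_adj_iff, hv2, hw2] at h'
    · exact (hlt h.symm hvw).symm
  have hs_surj := Finite.injective_iff_surjective.1 hs_inj
  refine ⟨isoOfInjective s hs_inj hadj, fun X => ⟨r X, hr X, ?_⟩, fun A => ?_⟩
  · change s '' X.1 = (r X).1
    refine Set.Subset.antisymm ?_ fun w hw => ?_
    · rintro _ ⟨v, hv, rfl⟩
      exact hsr hv
    · obtain ⟨v, rfl⟩ := hs_surj w
      exact ⟨v, hr_inj (huniq (hsr (hm v)) hw) ▸ hm v, rfl⟩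
  · change ∃ A', ϱ (Sum.inr A) = Sum.inr A' ∧ s '' A.1 = A'.1
    obtain ⟨j, k, hjk, Y, hY, hA⟩ := A.2
    have hAY : A.1 ⊆ Y := by
      obtain ⟨-, _, -, B, -, h⟩ := hA
      exact h ▸ Set.inter_subset_right
    obtain ⟨a, ha⟩ := hA.1
    -- The level chosen for `Y` must be `k`, since the nonempty set `A` lies in `Y` and levels are
    -- disjoint.
    have hk : k = lev ⟨Y, k, hY⟩ :=
      hL.level_unique k _ Y hY Y (hlev ⟨Y, k, hY⟩) a (hAY ha) (hAY ha)
    obtain ⟨A', h1, h2⟩ := hfA (X := ⟨Y, k, hY⟩) (hk ▸ hjk) hA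
    refine ⟨A', h1, ?_⟩
    rw [← h2]
    exact Set.image_congr fun x hx => hs (hAY hx)

/-! ### Level-preserving graph automorphisms act on the decomposition -/

section Restrict

variable {σ : H ≃g H} (hσ : ∀ i X, σ '' X ∈ 𝓧 i ↔ X ∈ 𝓧 i)
include hσ

lemma above_image (i : Fin ℓ) (v : V) : σ v ∈ above 𝓧 i ↔ v ∈ above 𝓧 i := by
  refine exists_congr fun k => and_congr_right fun _ => ?_
  rw [(iso_image_surjective σ).exists]
  simp only [hσ, σ.injective.mem_set_image]

lemma fragSep_image (i : Fin ℓ) (X : Set V) :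
    fragSep H 𝓧 i (σ '' X) = σ '' fragSep H 𝓧 i X := by
  ext x
  obtain ⟨x, rfl⟩ := σ.surjective x
  simp only [fragSep, Set.mem_ofPred_eq, σ.injective.mem_set_image, above_image hσ,
    Set.exists_mem_image, σ.map_adj_iff]

lemma image_mem_attachments {i : Fin ℓ} {X B : Set V} (hB : B ∈ attachments H 𝓧 i X) :
    σ '' B ∈ attachments H 𝓧 i (σ '' X) := by
  obtain ⟨v, hv, rfl⟩ := hB
  refine ⟨σ v, ⟨v, hv, rfl⟩, ?_⟩
  rw [fragSep_image hσ, Set.image_inter σ.injective]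
  congr 1
  ext x
  obtain ⟨x, rfl⟩ := σ.surjective x
  rw [σ.injective.mem_set_image, SimpleGraph.mem_neighborSet, SimpleGraph.mem_neighborSet,
    σ.map_adj_iff]

lemma image_mem_terminalsIn {j : Fin ℓ} {X A : Set V} (hA : A ∈ terminalsIn H 𝓧 j X) :
    σ '' A ∈ terminalsIn H 𝓧 j (σ '' X) := by
  obtain ⟨hne, Y, hY, B, hB, rfl⟩ := hA
  exact ⟨hne.image σ, σ '' Y, (hσ _ _).2 hY, σ '' B, image_mem_attachments hσ hB,
    Set.image_inter σ.injective⟩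

/-- A graph automorphism that preserves the levels induces an automorphism of the
decomposition. -/
theorem ActsAs.isDecompAut {ϱ : Equiv.Perm (Fragments 𝓧 ⊕ Terminals H 𝓧)}
    (h : ActsAs H 𝓧 σ ϱ) : IsDecompAut H 𝓧 ϱ := by
  refine ⟨fun i X hX => ?_, fun i k hik X A hX hA B hB => ?_⟩
  · obtain ⟨⟨_, hX'⟩, hϱ, rfl⟩ := h.1 X
    refine ⟨_, hϱ, (hσ _ _).2 hX, completionIso σ rfl (fragSep_image hσ i X.1), rfl,
      fun j hj A hA => ?_⟩
    obtain ⟨⟨_, hA'⟩, hϱA, rfl⟩ := h.2 A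
    exact ⟨_, hϱA, image_mem_terminalsIn hσ hA, completionIso_image_inCompletion _ _ _ _⟩
  · rintro ⟨Y, hY, hAB⟩
    obtain ⟨⟨_, hX'⟩, hϱ, rfl⟩ := h.1 X
    obtain ⟨⟨_, hA'⟩, hϱA, rfl⟩ := h.2 A
    refine ⟨_, _, hϱ, hϱA, σ '' B, image_mem_attachments hσ hB,
      ⟨completionIso σ rfl (fragSep_image hσ i X.1), rfl,
        completionIso_image_inCompletion _ _ _ _⟩, σ '' Y, (hσ _ _).2 hY, ?_⟩
    change σ '' A.1 = _
    rw [hAB, Set.image_inter σ.injective]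

end Restrict

end Aut

/-! ### Automorphisms of disjoint unions -/

section Sum

variable {U₁ U₂ V₁ V₂ : Type*} {A : SimpleGraph U₁} {B : SimpleGraph U₂} {C : SimpleGraph V₁}
  {D : SimpleGraph V₂}

lemma isLeft_eq_of_adj {x y : V₁ ⊕ V₂} (h : (C ⊕g D).Adj x y) : x.isLeft = y.isLeft := by
  rcases x with x | x <;> rcases y with y | y <;> simp at h ⊢

/-- No edge joins the two sides, so the side is constant along walks. -/
lemma forall_isLeft_or_isRight_of_connected (hA : A.Connected) (f : A →g C ⊕g D) :
    (∀ v, ∃ y, f v = Sum.inl y) ∨ ∀ v, ∃ y, f v = Sum.inr y := by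
  obtain ⟨v₀⟩ := hA.nonempty
  have key (v : U₁) : (f v).isLeft = (f v₀).isLeft := by
    obtain ⟨W⟩ := hA.preconnected v v₀
    induction W with
    | nil => rfl
    | cons h _ ih => exact (isLeft_eq_of_adj (f.map_adj h)).trans ih
  cases hv₀ : (f v₀).isLeft
  · exact Or.inr fun v => Sum.isRight_iff.1 (by
      rw [← Sum.not_isLeft, key v, hv₀]
      exact Bool.false_ne_true)
  · exact Or.inl fun v => Sum.isLeft_iff.1 ((key v).trans hv₀)

lemma exists_iso_left (σ : A ⊕g B ≃g C ⊕g D) (hl : ∀ v, ∃ y, σ (Sum.inl v) = Sum.inl y)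
    (hr : ∀ v, ∃ y, σ (Sum.inr v) = Sum.inr y) :
    ∃ e : A ≃g C, ∀ v, σ (Sum.inl v) = Sum.inl (e v) := by
  choose g hg using hl
  have hbij : Function.Bijective g := by
    refine ⟨fun v w h => ?_, fun y => ?_⟩
    · exact Sum.inl_injective (σ.injective (by rw [hg, hg, h]))
    · obtain ⟨x | x, hx⟩ := σ.surjective (Sum.inl y)
      · exact ⟨x, Sum.inl_injective ((hg x).symm.trans hx)⟩
      -- The assumption on the other summand is needed for surjectivity: it keeps images of `B` out
      -- of `C`.
      · obtain ⟨z, hz⟩ := hr x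
        exact absurd (hz.symm.trans hx) (by simp)
  refine ⟨⟨Equiv.ofBijective g hbij, fun {v w} => ?_⟩, hg⟩
  rw [Equiv.ofBijective_apply, Equiv.ofBijective_apply, ← SimpleGraph.sum_adj_inl (H := D), ← hg,
    ← hg, σ.map_adj_iff, SimpleGraph.sum_adj_inl]

lemma exists_iso_right (σ : A ⊕g B ≃g C ⊕g D) (hl : ∀ v, ∃ y, σ (Sum.inl v) = Sum.inl y)
    (hr : ∀ v, ∃ y, σ (Sum.inr v) = Sum.inr y) :
    ∃ e : B ≃g D, ∀ v, σ (Sum.inr v) = Sum.inr (e v) := by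
  obtain ⟨e, he⟩ := exists_iso_left
    ((SimpleGraph.Iso.sumComm.trans σ).trans SimpleGraph.Iso.sumComm : B ⊕g A ≃g D ⊕g C)
    (fun v => by obtain ⟨y, hy⟩ := hr v; exact ⟨y, by simp [hy]⟩)
    (fun v => by obtain ⟨y, hy⟩ := hl v; exact ⟨y, by simp [hy]⟩)
  refine ⟨e, fun v => ?_⟩
  have h : Sum.swap (σ (Sum.inr v)) = Sum.inl (e v) := he v
  exact Sum.swap_leftInverse.injective h

end Sum

/-! ### Graph automorphisms of the union permute the levels -/

section CombineAut

variable {V₁ : Type u} {V₂ : Type w} {ℓ : ℕ} {G₁ : SimpleGraph V₁} {G₂ : SimpleGraph V₂}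
  {𝓧₁ : Fin ℓ → Set (Set V₁)} {𝓧₂ : Fin ℓ → Set (Set V₂)}

/-- Automorphisms of a disjoint union of two connected graphs preserve the levels of the combined
canonical decomposition. -/
lemma image_mem_combine (hc₁ : G₁.Connected) (hc₂ : G₂.Connected)
    (h₁ : IsCanonicalDecomposition G₁ 𝓧₁) (h₂ : IsCanonicalDecomposition G₂ 𝓧₂)
    (σ : G₁ ⊕g G₂ ≃g G₁ ⊕g G₂) {i : Fin ℓ} {X : Set (V₁ ⊕ V₂)} (hX : X ∈ combine 𝓧₁ 𝓧₂ i) :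
    σ '' X ∈ combine 𝓧₁ 𝓧₂ i := by
  rcases forall_isLeft_or_isRight_of_connected hc₁
    (σ.toHom.comp SimpleGraph.Embedding.sumInl.toHom) with hl | hl <;>
  rcases forall_isLeft_or_isRight_of_connected hc₂
    (σ.toHom.comp SimpleGraph.Embedding.sumInr.toHom) with hr | hr
  -- Both graphs cannot be sent into the same side, by surjectivity.
  · obtain ⟨y⟩ := hc₂.nonempty
    obtain ⟨x | x, hx⟩ := σ.surjective (Sum.inr y)
    · obtain ⟨z, hz⟩ := hl x
      cases hz.symm.trans hx
    · obtain ⟨z, hz⟩ := hr x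
      cases hz.symm.trans hx
  · obtain ⟨e₁, he₁⟩ := exists_iso_left σ hl hr
    obtain ⟨e₂, he₂⟩ := exists_iso_right σ hl hr
    rcases hX with ⟨Y, hY, rfl⟩ | ⟨Y, hY, rfl⟩
    · refine Or.inl ⟨e₁ '' Y, (h₁.mem_image_iff h₁ e₁ i Y).2 hY, ?_⟩
      simp only [Set.image_image, he₁]
    · refine Or.inr ⟨e₂ '' Y, (h₂.mem_image_iff h₂ e₂ i Y).2 hY, ?_⟩
      simp only [Set.image_image, he₂]
  -- Here `σ` swaps the two graphs; after composing with the swap it splits into isomorphisms `G₁ ≃g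
  -- G₂` and `G₂ ≃g G₁`, which carry one canonical decomposition to the other.
  · have hl' (v : V₁) : ∃ y, (σ.trans SimpleGraph.Iso.sumComm) (Sum.inl v) = Sum.inl y := by
      obtain ⟨y, hy⟩ := hl v
      exact ⟨y, congrArg Sum.swap hy⟩
    have hr' (v : V₂) : ∃ y, (σ.trans SimpleGraph.Iso.sumComm) (Sum.inr v) = Sum.inr y := by
      obtain ⟨y, hy⟩ := hr v
      exact ⟨y, congrArg Sum.swap hy⟩
    obtain ⟨e₁, he₁⟩ := exists_iso_left (σ.trans SimpleGraph.Iso.sumComm) hl' hr'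
    obtain ⟨e₂, he₂⟩ := exists_iso_right (σ.trans SimpleGraph.Iso.sumComm) hl' hr'
    replace he₁ (v : V₁) : σ (Sum.inl v) = Sum.inr (e₁ v) := Sum.swap_leftInverse.injective (he₁ v)
    replace he₂ (v : V₂) : σ (Sum.inr v) = Sum.inl (e₂ v) := Sum.swap_leftInverse.injective (he₂ v)
    rcases hX with ⟨Y, hY, rfl⟩ | ⟨Y, hY, rfl⟩
    · refine Or.inr ⟨e₁ '' Y, (h₁.mem_image_iff h₂ e₁ i Y).2 hY, ?_⟩
      simp only [Set.image_image, he₁]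
    · refine Or.inl ⟨e₂ '' Y, (h₂.mem_image_iff h₁ e₂ i Y).2 hY, ?_⟩
      simp only [Set.image_image, he₂]
  · obtain ⟨y⟩ := hc₁.nonempty
    obtain ⟨x | x, hx⟩ := σ.surjective (Sum.inl y)
    · obtain ⟨z, hz⟩ := hl x
      cases hz.symm.trans hx
    · obtain ⟨z, hz⟩ := hr x
      cases hz.symm.trans hx

end CombineAut

end TGraphDecomp

theorem proposition1 {τ V₁ V₂ : Type*} [Finite τ] [Finite V₁] [Finite V₂]
    (T : SimpleGraph τ) (hT : T.IsTree)
    (G₁ : SimpleGraph V₁) (G₂ : SimpleGraph V₂)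
    (hG₁ : TGraphDecomp.IsTGraph T G₁) (hG₂ : TGraphDecomp.IsTGraph T G₂)
    (hc₁ : G₁.Connected) (hc₂ : G₂.Connected)
    (ℓ : ℕ) (𝓧₁ : Fin ℓ → Set (Set V₁)) (𝓧₂ : Fin ℓ → Set (Set V₂))
    (h₁ : TGraphDecomp.IsCanonicalDecomposition G₁ 𝓧₁)
    (h₂ : TGraphDecomp.IsCanonicalDecomposition G₂ 𝓧₂)
    (ϱ : Equiv.Perm (TGraphDecomp.Fragments (TGraphDecomp.combine 𝓧₁ 𝓧₂) ⊕
      TGraphDecomp.Terminals (G₁ ⊕g G₂) (TGraphDecomp.combine 𝓧₁ 𝓧₂))) :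
    TGraphDecomp.IsDecompAut (G₁ ⊕g G₂) (TGraphDecomp.combine 𝓧₁ 𝓧₂) ϱ ↔
      ∃ σ : (G₁ ⊕g G₂) ≃g (G₁ ⊕g G₂),
        TGraphDecomp.ActsAs (G₁ ⊕g G₂) (TGraphDecomp.combine 𝓧₁ 𝓧₂) σ ϱ := by
  refine ⟨fun h => (h₁.isLayered.combine h₂.isLayered).exists_actsAs h, ?_⟩
  rintro ⟨σ, hσ⟩
  refine hσ.isDecompAut fun i X =>
    ⟨fun h => ?_, TGraphDecomp.image_mem_combine hc₁ hc₂ h₁ h₂ σ⟩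
  -- The converse inclusion is the same fact for the inverse of `σ`.
  rw [← TGraphDecomp.image_symm_image σ X]
  exact TGraphDecomp.image_mem_combine hc₁ hc₂ h₁ h₂ σ.symm h
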